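/- Let $u=u(\rho,\theta)$ be a real function on a polar rectangle $S=\{\rho\ge 1,\ |\theta|\le 3\pi\}$, where the angle is not taken modulo $2\pi$, continuous on $S$ and smooth in its interior. Let $\nabla$, $\mathrm{Hess}$, $\mathrm{div}$ be the Euclidean operators in the local coordinates $x=\rho\cos\theta$, $y=\rho\sin\theta$, with Euclidean norms, and let $w(\rho,\theta)=u(\rho,\theta+2\pi)-u(\rho,\theta)$, for $-3\pi\le\theta\le\pi$, be the separation of $u$. The multivalued graph $\Gamma_u=\{(\rho\cos\theta,\rho\sin\theta,u(\rho,\theta)) : (\rho,\theta)\in S\}$ is called a $3$-valued $\epsilon$-sheet (centered at $0$) on scale $1$ if $\epsilon<\frac1{2\pi}$ and 1. $\mathrm{div}\big(\nabla u/\sqrt{1+|\nabla u|^2}\big)=0$ and $|\nabla u|\le\epsilon$ in the interior of $S$; 2. $\Gamma_u\subset\{x\in\mathbb R^3 : x_3^2\le\epsilon^2(x_1^2+x_2^2)\}$; 3. for $\rho>1$ and $-3\pi<\theta<\pi$ (where $w$ is defined) one has $w\neq0$ and $$|\nabla u|+\rho|\mathrm{Hess}_u|+4\rho\frac{|\nabla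 w|}{|w|}+\rho^2\frac{|\mathrm{Hess}_w|}{|w|}\le\epsilon;$$ 4. $\lim_{\rho\to\infty}\nabla u(\rho,0)=0$. **Proposition.** There exists $\epsilon_0>0$ such that for every $C_2>0$ there is $C_3=C_3(C_2)\ge 2$, depending only on $C_2$, with the following property. If $\Gamma_u$ is a $3$-valued $\epsilon$-sheet on scale $1$ with $\epsilon<\epsilon_0$ and $w(1,\theta)\ge C_2$ for all $\theta\in[-3\pi,\pi]$, then for all $\rho\ge C_3$ and $-\pi\le\theta\le\pi$ $$u_\theta(\rho,\theta)\ \ge\ \frac{C_2}{8\pi}\,\rho^{-\epsilon}.$$ In particular $u_\theta\neq0$ there, i.e. $\Gamma_u$ strictly spirals over $\{\rho\ge C_3,\ |\theta|\le\pi\}$. -/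

import Mathlib

open scoped ContDiff

noncomputable section

namespace MultiGraph

/-- The unbounded closed polar rectangle of all `(ρ, θ)` with `r ≤ ρ < ∞` and `a ≤ θ ≤ b`. -/
def polarRect (r a b : ℝ) : Set (ℝ × ℝ) := Set.Ici r ×ˢ Set.Icc a b

/-- The interior of `polarRect r a b`. -/
def openPolarRect (r a b : ℝ) : Set (ℝ × ℝ) := Set.Ioi r ×ˢ Set.Ioo a b

/-- The derivative `∂u/∂ρ` of a function `u (ρ, θ)` on a polar domain. -/
def dRho (u : ℝ → ℝ → ℝ) (ρ θ : ℝ) : ℝ := deriv (fun r => u r θ) ρ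

/-- The derivative `∂u/∂θ` of a function `u (ρ, θ)` on a polar domain. -/
def dTheta (u : ℝ → ℝ → ℝ) (ρ θ : ℝ) : ℝ := deriv (fun t => u ρ t) θ

/-- The derivative `u_x` with respect to the (local) Cartesian coordinate `x = ρ cos θ`. -/
def dX (u : ℝ → ℝ → ℝ) (ρ θ : ℝ) : ℝ :=
  Real.cos θ * dRho u ρ θ - Real.sin θ / ρ * dTheta u ρ θ

/-- The derivative `u_y` with respect to the (local) Cartesian coordinate `y = ρ sin θ`. -/
def dY (u : ℝ → ℝ → ℝ) (ρ θ : ℝ) : ℝ :=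
  Real.sin θ * dRho u ρ θ + Real.cos θ / ρ * dTheta u ρ θ

/-- `|∇u|`, the Euclidean norm of the Cartesian gradient. -/
def gradNorm (u : ℝ → ℝ → ℝ) (ρ θ : ℝ) : ℝ :=
  Real.sqrt (dX u ρ θ ^ 2 + dY u ρ θ ^ 2)

/-- `|Hess_u|`, the Euclidean (Hilbert-Schmidt) norm of the Cartesian Hessian. -/
def hessNorm (u : ℝ → ℝ → ℝ) (ρ θ : ℝ) : ℝ :=
  Real.sqrt (dX (dX u) ρ θ ^ 2 + dX (dY u) ρ θ ^ 2 + dY (dX u) ρ θ ^ 2 + dY (dY u) ρ θ ^ 2)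

/-- The minimal surface equation `div (∇u / √(1 + |∇u|²)) = 0` at the point `(ρ, θ)`. -/
def MinimalSurfaceEqAt (u : ℝ → ℝ → ℝ) (ρ θ : ℝ) : Prop :=
  dX (fun r t => dX u r t / Real.sqrt (1 + gradNorm u r t ^ 2)) ρ θ +
    dY (fun r t => dY u r t / Real.sqrt (1 + gradNorm u r t ^ 2)) ρ θ = 0

/-- The separation `w (ρ, θ) = u (ρ, θ + 2π) - u (ρ, θ)`. -/
def separation (u : ℝ → ℝ → ℝ) (ρ θ : ℝ) : ℝ := u ρ (θ + 2 * Real.pi) - u ρ θ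

/-- The map `Φ_u (ρ, θ) = (ρ cos θ, ρ sin θ, u (ρ, θ))`. -/
def graphMap (u : ℝ → ℝ → ℝ) (p : ℝ × ℝ) : EuclideanSpace ℝ (Fin 3) :=
  !₂[p.1 * Real.cos p.2, p.1 * Real.sin p.2, u p.1 p.2]

/-- The multivalued graph `Γ_u = Φ_u (Ω)` over a polar domain `Ω`. -/
def graph (Ω : Set (ℝ × ℝ)) (u : ℝ → ℝ → ℝ) : Set (EuclideanSpace ℝ (Fin 3)) :=
  graphMap u '' Ω

/-- The complement of a cone, `C_δ = {x : x₃² ≤ δ² (x₁² + x₂²)}`. -/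
def coneComplement (δ : ℝ) : Set (EuclideanSpace ℝ (Fin 3)) :=
  {x | x 2 ^ 2 ≤ δ ^ 2 * (x 0 ^ 2 + x 1 ^ 2)}

/-- The flatness condition
`|∇u| + ρ |Hess_u| + 4 ρ |∇w| / |w| + ρ² |Hess_w| / |w| ≤ ε` at the point `(ρ, θ)`, where `w` is
the separation of `u`, together with `w ≠ 0`, which the quotients presuppose. -/
def FlatAt (ε : ℝ) (u : ℝ → ℝ → ℝ) (ρ θ : ℝ) : Prop :=
  separation u ρ θ ≠ 0 ∧
    gradNorm u ρ θ + ρ * hessNorm u ρ θ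
      + 4 * ρ * (gradNorm (separation u) ρ θ / |separation u ρ θ|)
      + ρ ^ 2 * (hessNorm (separation u) ρ θ / |separation u ρ θ|) ≤ ε

/-- `Γ_u` is a weak `N`-valued `ε`-sheet on the scale `s`, centered at the origin. Only the values
of `u` on the closed polar rectangle matter; differential conditions are imposed in its interior. -/
structure IsWeakSheet (N : ℕ) (ε s : ℝ) (u : ℝ → ℝ → ℝ) : Prop where
  scale_pos : 0 < s
  continuousOn : ContinuousOn (Function.uncurry u)
    (polarRect s (-(Real.pi * N)) (Real.pi * N))
  smoothOn : ContDiffOn ℝ ∞ (Function.uncurry u)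
    (openPolarRect s (-(Real.pi * N)) (Real.pi * N))
  minimal : ∀ ρ θ : ℝ, (ρ, θ) ∈ openPolarRect s (-(Real.pi * N)) (Real.pi * N) →
    MinimalSurfaceEqAt u ρ θ
  gradNorm_le : ∀ ρ θ : ℝ, (ρ, θ) ∈ openPolarRect s (-(Real.pi * N)) (Real.pi * N) →
    gradNorm u ρ θ ≤ ε
  subset_cone : graph (polarRect s (-(Real.pi * N)) (Real.pi * N)) u ⊆ coneComplement ε

/-- `Γ_u` is a (strong) `N`-valued `ε`-sheet on the scale `s`, centered at the origin. The flatness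
condition involves the separation, so it is imposed where the separation is defined, that is for
angles between `-πN` and `πN - 2π`. -/
structure IsSheet (N : ℕ) (ε s : ℝ) (u : ℝ → ℝ → ℝ) : Prop extends IsWeakSheet N ε s u where
  eps_lt : ε < 1 / (2 * Real.pi)
  flat : ∀ ρ θ : ℝ,
    (ρ, θ) ∈ openPolarRect s (-(Real.pi * N)) (Real.pi * N - 2 * Real.pi) → FlatAt ε u ρ θ
  tendsto_dX : Filter.Tendsto (fun ρ => dX u ρ 0) Filter.atTop (nhds 0)
  tendsto_dY : Filter.Tendsto (fun ρ => dY u ρ 0) Filter.atTop (nhds 0)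

end MultiGraph

end

namespace MultiGraph

open Set Filter Topology MeasureTheory
open scoped Interval

/-! Work in `(s, t) = (log ρ, θ)` with `v = u` and `(p, q) = ∇u`. Fix `t₀ ∈ [-π, π]` and let `U (s,
x) = v (s, t₀ + x) - v (s, t₀ - x)` for `x ∈ [0, π]`. Then `U = 0` at `x = 0`, and `∂U/∂x = 2 u_θ`
there. At `x = π`, `U` is the separation at the angle `t₀ - π`, which flatness keeps above `C₂
e^{-εs/4}` (`IsSheet.sep_bounds`). So a lower barrier for `U` that vanishes at `x = 0` with positive
slope bounds `u_θ` from below.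

`U` is the difference of two solutions of the minimal surface equation with small gradient, the
sheet and its reflection, hence almost harmonic. Wherever `U - b` has a local minimum, the Laplacian
of `b` is at most `10 ε²` times its first and second derivatives (`laplacian_le_of_isLocalMin`). The
explicit `barrier` violates this everywhere on the strip (`barrier_strict_subsolution`), so
comparing boundary values suffices (`barrier_le`).

The strip is unbounded and this is a Phragmén–Lindelöf argument. The critical harmonic function of
the strip is `e^s sin x`, and the cone condition only gives `U = O(e^s)`, so a definite gain in the
exponent is needed. It comes from the gradient map `(p, q)`, which reverses orientation with
Jacobian comparable to its Dirichlet density (`jacobian_le`). Let `B = ∮ p dq` over one full turn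
and let `E` be the energy on that turn. Then `B' ≤ -E/4` and `|B| ≤ 4E`, up to exponentially small
errors because the turn fails to close only by the jump of the gradient. Hence `E` is summable
against a growing exponential. Together with `∇u → 0` along one ray, the mean square gradient decays
like `e^{-s/64}` (`exists_le_exp_of_energy`, `exists_mass_le`), and `U = O(e^{127s/128})`
(`exists_abs_sub_le`). -/

/-- The partial derivative in the first variable. -/
noncomputable def pd1 (g : ℝ × ℝ → ℝ) (z : ℝ × ℝ) : ℝ := fderiv ℝ g z (1, 0)

/-- The partial derivative in the second variable. -/
noncomputable def pd2 (g : ℝ × ℝ → ℝ) (z : ℝ × ℝ) : ℝ := fderiv ℝ g z (0, 1)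

/-! ### Partial derivatives of smooth functions of two variables -/

section Partial

variable {g : ℝ × ℝ → ℝ} {Ω : Set (ℝ × ℝ)} {z : ℝ × ℝ}

theorem contDiffOn_pd1 (hΩ : IsOpen Ω) (hg : ContDiffOn ℝ ∞ g Ω) : ContDiffOn ℝ ∞ (pd1 g) Ω :=
  (hg.fderiv_of_isOpen (m := ∞) hΩ (by simp)).clm_apply contDiffOn_const

theorem contDiffOn_pd2 (hΩ : IsOpen Ω) (hg : ContDiffOn ℝ ∞ g Ω) : ContDiffOn ℝ ∞ (pd2 g) Ω :=
  (hg.fderiv_of_isOpen (m := ∞) hΩ (by simp)).clm_apply contDiffOn_const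

theorem differentiableAt_of_contDiffOn (hΩ : IsOpen Ω) (hg : ContDiffOn ℝ ∞ g Ω) (hz : z ∈ Ω) :
    DifferentiableAt ℝ g z :=
  (hg.contDiffAt (hΩ.mem_nhds hz)).differentiableAt (by simp)

theorem fderiv_apply_eq_pd (d : ℝ × ℝ) : fderiv ℝ g z d = pd1 g z * d.1 + pd2 g z * d.2 := by
  have : d = d.1 • ((1, 0) : ℝ × ℝ) + d.2 • ((0, 1) : ℝ × ℝ) := by ext <;> simp
  conv_lhs => rw [this]
  simp only [map_add, map_smul, smul_eq_mul, pd1, pd2]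
  ring

theorem hasDerivAt_comp_pd {f₁ f₂ : ℝ → ℝ} {d₁ d₂ t : ℝ} (hg : DifferentiableAt ℝ g (f₁ t, f₂ t))
    (h₁ : HasDerivAt f₁ d₁ t) (h₂ : HasDerivAt f₂ d₂ t) :
    HasDerivAt (fun t => g (f₁ t, f₂ t))
      (pd1 g (f₁ t, f₂ t) * d₁ + pd2 g (f₁ t, f₂ t) * d₂) t := by
  have := hg.hasFDerivAt.comp_hasDerivAt t (h₁.prodMk h₂)
  rwa [fderiv_apply_eq_pd] at this

theorem hasDerivAt_fst {s θ : ℝ} (hg : DifferentiableAt ℝ g (s, θ)) :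
    HasDerivAt (fun r => g (r, θ)) (pd1 g (s, θ)) s := by
  simpa using hasDerivAt_comp_pd (f₁ := fun t => t) (f₂ := fun _ => θ) hg (hasDerivAt_id s)
    (hasDerivAt_const s θ)

theorem hasDerivAt_snd {s θ : ℝ} (hg : DifferentiableAt ℝ g (s, θ)) :
    HasDerivAt (fun t => g (s, t)) (pd2 g (s, θ)) θ := by
  simpa using hasDerivAt_comp_pd (f₁ := fun _ => s) (f₂ := fun t => t) hg (hasDerivAt_const θ s)
    (hasDerivAt_id θ)

theorem pd1_congr {h : ℝ × ℝ → ℝ} (H : g =ᶠ[𝓝 z] h) : pd1 g z = pd1 h z := by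
  simp only [pd1, H.fderiv_eq]

theorem pd2_congr {h : ℝ × ℝ → ℝ} (H : g =ᶠ[𝓝 z] h) : pd2 g z = pd2 h z := by
  simp only [pd2, H.fderiv_eq]

theorem pd1_eq_of_hasDerivAt {s θ d : ℝ} (hg : DifferentiableAt ℝ g (s, θ))
    (h : HasDerivAt (fun r => g (r, θ)) d s) : pd1 g (s, θ) = d :=
  (hasDerivAt_fst hg).unique h

theorem pd2_eq_of_hasDerivAt {s θ d : ℝ} (hg : DifferentiableAt ℝ g (s, θ))
    (h : HasDerivAt (fun t => g (s, t)) d θ) : pd2 g (s, θ) = d :=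
  (hasDerivAt_snd hg).unique h

theorem pd1_pd2_comm (hΩ : IsOpen Ω) (hg : ContDiffOn ℝ ∞ g Ω) (hz : z ∈ Ω) :
    pd1 (pd2 g) z = pd2 (pd1 g) z := by
  have hc : ContDiffAt ℝ ∞ g z := hg.contDiffAt (hΩ.mem_nhds hz)
  have hs : IsSymmSndFDerivAt ℝ g z := hc.isSymmSndFDerivAt (by simpa using WithTop.coe_le_coe.2 (le_top (a := (2 : ℕ∞))))
  have hd : DifferentiableAt ℝ (fderiv ℝ g) z :=
    ((hg.fderiv_of_isOpen (m := ∞) hΩ (by simp)).contDiffAt (hΩ.mem_nhds hz)).differentiableAt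
      (by simp)
  have e (a b : ℝ × ℝ) : fderiv ℝ (fun y => fderiv ℝ g y a) z b = fderiv ℝ (fderiv ℝ g) z b a := by
    have := hd.hasFDerivAt.clm_apply (hasFDerivAt_const a z)
    rw [this.fderiv]; simp
  change fderiv ℝ (fun y => fderiv ℝ g y (0, 1)) z (1, 0) =
    fderiv ℝ (fun y => fderiv ℝ g y (1, 0)) z (0, 1)
  rw [e, e]
  exact hs _ _

end Partial

/-! ### One-variable calculus and integral inequalities -/

/-- The second derivative at an interior local minimum is nonnegative. -/
theorem IsLocalMin.nonneg_of_hasDerivAt {f f' : ℝ → ℝ} {x c : ℝ} (hm : IsLocalMin f x)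
    (hf : ∀ᶠ t in 𝓝 x, HasDerivAt f (f' t) t) (hf' : HasDerivAt f' c x) : 0 ≤ c := by
  by_contra! hc
  have hd : deriv f =ᶠ[𝓝 x] f' := hf.mono fun t ht => ht.deriv
  have h2 : deriv (deriv f) x = c := by rw [hd.deriv_eq, hf'.deriv]
  have h1 : deriv f x = 0 := hm.deriv_eq_zero
  -- If `c < 0`, the second derivative test makes `x` a local maximum as well, so `f` is locally
  -- constant and `c = 0`.
  have hM : IsLocalMax f x :=
    isLocalMax_of_deriv_deriv_neg (by rw [h2]; exact hc) h1 hf.self_of_nhds.continuousAt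
  have hconst : f =ᶠ[𝓝 x] fun _ => f x := by
    filter_upwards [hm, hM] with t h₁ h₂ using le_antisymm h₂ h₁
  have hd0 : deriv f =ᶠ[𝓝 x] fun _ => (0 : ℝ) := by
    have := hconst.deriv
    simpa using this
  rw [hd0.deriv_eq, deriv_const] at h2
  exact hc.ne h2.symm

/-- Differentiation under the integral sign over a compact interval. -/
theorem hasDerivAt_intervalIntegral_param {g g' : ℝ × ℝ → ℝ} {I : Set ℝ} {a b s : ℝ} (hab : a ≤ b)
    (hI : IsOpen I) (hs : s ∈ I) (hg : ContinuousOn g (I ×ˢ Icc a b))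
    (hg' : ContinuousOn g' (I ×ˢ Icc a b))
    (hd : ∀ r ∈ I, ∀ t ∈ Icc a b, HasDerivAt (fun r => g (r, t)) (g' (r, t)) r) :
    HasDerivAt (fun r => ∫ t in a..b, g (r, t)) (∫ t in a..b, g' (s, t)) s := by
  obtain ⟨δ, hδ, hball⟩ := Metric.isOpen_iff.1 hI s hs
  have hsub : Metric.closedBall s (δ / 2) ⊆ I :=
    (Metric.closedBall_subset_ball (by linarith)).trans hball
  have hK : IsCompact (Metric.closedBall s (δ / 2) ×ˢ Icc a b) :=
    (isCompact_closedBall s _).prod isCompact_Icc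
  obtain ⟨C, hC⟩ := hK.exists_bound_of_continuousOn (hg'.mono (prod_mono hsub subset_rfl))
  have hslice (k : ℝ × ℝ → ℝ) (hk : ContinuousOn k (I ×ˢ Icc a b)) (r : ℝ) (hr : r ∈ I) :
      ContinuousOn (fun t => k (r, t)) (Icc a b) :=
    hk.comp (by fun_prop) fun t ht => ⟨hr, ht⟩
  have hmeas (k : ℝ × ℝ → ℝ) (hk : ContinuousOn k (I ×ˢ Icc a b)) (r : ℝ) (hr : r ∈ I) :
      AEStronglyMeasurable (fun t => k (r, t)) (volume.restrict (Ι a b)) := by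
    rw [uIoc_of_le hab]
    exact ((hslice k hk r hr).mono Ioc_subset_Icc_self).aestronglyMeasurable measurableSet_Ioc
  refine (intervalIntegral.hasDerivAt_integral_of_dominated_loc_of_deriv_le
    (F := fun r t => g (r, t)) (F' := fun r t => g' (r, t)) (bound := fun _ => C)
    (Metric.closedBall_mem_nhds s (half_pos hδ)) ?_ ?_ ?_ ?_ ?_ ?_).2
  · filter_upwards [hI.mem_nhds hs] with r hr using hmeas g hg r hr
  · apply ContinuousOn.intervalIntegrable
    rw [uIcc_of_le hab]
    exact hslice g hg s hs
  · exact hmeas g' hg' s hs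
  · refine Eventually.of_forall fun t ht r hr => hC (r, t) ⟨hr, ?_⟩
    rw [uIoc_of_le hab] at ht
    exact Ioc_subset_Icc_self ht
  · exact intervalIntegrable_const
  · refine Eventually.of_forall fun t ht r hr => hd r (hsub hr) t ?_
    rw [uIoc_of_le hab] at ht
    exact Ioc_subset_Icc_self ht

/-- The Cauchy–Schwarz inequality for the integral of a function against `1`. -/
theorem sq_integral_abs_le {g : ℝ → ℝ} {a b : ℝ} (hab : a < b) (hg : ContinuousOn g (Icc a b)) :
    (∫ t in a..b, |g t|) ^ 2 ≤ (b - a) * ∫ t in a..b, g t ^ 2 := by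
  set X := ∫ t in a..b, |g t| with hX
  -- `l` is the mean of `|g|`; the inequality is the integral of `(|g| - l)² ≥ 0`.
  set l := X / (b - a) with hl
  have hba : 0 < b - a := by linarith
  have hu : uIcc a b = Icc a b := uIcc_of_le hab.le
  have i1 : IntervalIntegrable (fun t => |g t|) volume a b :=
    ContinuousOn.intervalIntegrable (by rw [hu]; exact hg.abs)
  have i2 : IntervalIntegrable (fun t => g t ^ 2) volume a b :=
    ContinuousOn.intervalIntegrable (by rw [hu]; exact hg.pow 2)
  have h : ∫ t in a..b, (2 * l * |g t|) ≤ ∫ t in a..b, (g t ^ 2 + l ^ 2) := by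
    apply intervalIntegral.integral_mono_on hab.le (i1.const_mul _)
      (i2.add intervalIntegrable_const)
    intro t _
    nlinarith [sq_nonneg (|g t| - l), sq_abs (g t)]
  rw [intervalIntegral.integral_const_mul, intervalIntegral.integral_add i2
    intervalIntegrable_const, intervalIntegral.integral_const, smul_eq_mul] at h
  have hXl : X = l * (b - a) := by rw [hl]; field_simp
  rw [← hX] at h
  have : l * X ≤ ∫ t in a..b, g t ^ 2 := by
    have : (b - a) * l ^ 2 = l * X := by rw [hXl]; ring
    linarith
  calc X ^ 2 = (b - a) * (l * X) := by rw [hXl]; ring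
    _ ≤ _ := mul_le_mul_of_nonneg_left this hba.le

theorem antitoneOn_Ici_of_hasDerivAt {f f' : ℝ → ℝ} {a : ℝ}
    (hf : ∀ s, a ≤ s → HasDerivAt f (f' s) s) (h : ∀ s, a ≤ s → f' s ≤ 0) :
    AntitoneOn f (Ici a) := by
  refine antitoneOn_of_deriv_nonpos (convex_Ici a)
    (fun s hs => (hf s hs).continuousAt.continuousWithinAt)
    (fun s hs => (hf s (interior_subset hs)).differentiableAt.differentiableWithinAt) ?_
  intro s hs
  rw [(hf s (interior_subset hs)).deriv]
  exact h s (interior_subset hs)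

theorem exists_forall_exp_neg_lt {a δ : ℝ} (ha : 0 < a) (hδ : 0 < δ) (K : ℝ) :
    ∃ S : ℝ, ∀ s, S ≤ s → K * Real.exp (-(a * s)) < δ := by
  have h : Tendsto (fun s : ℝ => K * Real.exp (-(a * s))) atTop (𝓝 (K * 0)) :=
    (Real.tendsto_exp_neg_atTop_nhds_zero.comp
      (tendsto_id.const_mul_atTop ha)).const_mul K
  rw [mul_zero] at h
  exact eventually_atTop.1 (h.eventually (gt_mem_nhds hδ))

/-! ### Decay from an energy inequality -/

/-- Exponential decay of `Ψ` from a differential inequality for the energy `E`, in which the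
quantity `B` is controlled by `E`, up to exponentially small errors. -/
theorem exists_le_exp_of_energy {B E Ψ B' Ψ' : ℝ → ℝ} {K : ℝ} (hK : 0 ≤ K)
    (hB : ∀ s, 1 ≤ s → HasDerivAt B (B' s) s) (hΨ : ∀ s, 1 ≤ s → HasDerivAt Ψ (Ψ' s) s)
    (hB' : ∀ s, 1 ≤ s → B' s ≤ -(1 / 4 * E s) + K * Real.exp (-(1 / 2 * s)))
    (hBE : ∀ s, 1 ≤ s → |B s| ≤ 4 * E s + K * Real.exp (-(1 / 2 * s)))
    (hE : ∀ s, 1 ≤ s → 0 ≤ E s) (hB0 : ∀ s, 1 ≤ s → -K ≤ B s)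
    (hΨ' : ∀ s, 1 ≤ s →
      |Ψ' s| ≤ K * (Real.exp (1 / 64 * s) * E s + Real.exp (-(1 / 64 * s))))
    (hΨE : ∀ η > 0, ∃ δ > 0, ∃ S, ∀ s, S ≤ s → E s < δ → Ψ s < η) :
    ∃ C, ∀ s, 1 ≤ s → Ψ s ≤ C * Real.exp (-(1 / 64 * s)) := by
  have dexp (a s : ℝ) : HasDerivAt (fun s => Real.exp (a * s)) (a * Real.exp (a * s)) s := by
    have := ((hasDerivAt_id s).const_mul a).exp
    simpa [mul_comm] using this
  have dexpn (a s : ℝ) :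
      HasDerivAt (fun s => Real.exp (-(a * s))) (-a * Real.exp (-(a * s))) s := by
    simpa using dexp (-a) s
  -- The added term has derivative `-K e^{-s/2}`, which cancels the error in `hB'`.
  set H : ℝ → ℝ := fun s => B s + 2 * K * Real.exp (-(1 / 2 * s)) with hH
  set H' : ℝ → ℝ := fun s => B' s + 2 * K * (-(1 / 2) * Real.exp (-(1 / 2 * s))) with hH'
  have dH (s : ℝ) (hs : 1 ≤ s) : HasDerivAt H (H' s) s :=
    (hB s hs).add ((dexpn _ s).const_mul _)
  have H'le (s : ℝ) (hs : 1 ≤ s) : H' s ≤ -(1 / 4 * E s) := by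
    have := hB' s hs
    simp only [hH']; linarith
  have Hle (s : ℝ) (hs : 1 ≤ s) : H s ≤ 4 * E s + 3 * K * Real.exp (-(1 / 2 * s)) := by
    have := (le_abs_self _).trans (hBE s hs)
    simp only [hH]; linarith
  have Hge (s : ℝ) (hs : 1 ≤ s) : -(4 * E s + 3 * K * Real.exp (-(1 / 2 * s))) ≤ H s := by
    have := (neg_abs_le (B s))
    have h2 := hBE s hs
    have h3 : 0 ≤ K * Real.exp (-(1 / 2 * s)) := by positivity
    simp only [hH]; linarith
  have Hbdd (s : ℝ) (hs : 1 ≤ s) : -K ≤ H s := by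
    have := hB0 s hs
    have h3 : 0 ≤ K * Real.exp (-(1 / 2 * s)) := by positivity
    simp only [hH]; linarith
  -- If `E` stayed above `δ`, then `H` would fall at rate at least `δ/4` and cross its lower bound
  -- `-K` by the time `T`.
  have small (δ : ℝ) (hδ : 0 < δ) (S : ℝ) (hS : 1 ≤ S) : ∃ s, S ≤ s ∧ E s < δ := by
    by_contra! hcon
    have anti : AntitoneOn (fun s => H s + δ / 4 * s) (Ici S) := by
      refine antitoneOn_Ici_of_hasDerivAt (f' := fun s => H' s + δ / 4 * 1)
        (fun s hs => (dH s (hS.trans hs)).add ((hasDerivAt_id s).const_mul _)) fun s hs => ?_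
      have h1 := H'le s (hS.trans hs)
      have h2 := hcon s hs
      linarith
    set T := S + 4 / δ * (H S + K + 1) with hT
    have hST : S ≤ T := by
      have := Hbdd S hS
      have h : 0 ≤ 4 / δ * (H S + K + 1) := by apply mul_nonneg <;> [positivity; linarith]
      linarith
    have h1 := anti (mem_Ici.2 le_rfl) (mem_Ici.2 hST) hST
    have h2 := Hbdd T (hS.trans hST)
    have h3 : δ / 4 * T = δ / 4 * S + (H S + K + 1) := by rw [hT]; field_simp
    simp only at h1
    linarith
  have Hanti : AntitoneOn H (Ici 1) := antitoneOn_Ici_of_hasDerivAt dH fun s hs => by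
    have := H'le s hs
    have := hE s hs
    linarith
  -- A negative value would persist by monotonicity, but `H ≥ -(4E + 3K e^{-s/2})` and the right
  -- side is arbitrarily close to `0` at late times of small energy.
  have Hnonneg (s : ℝ) (hs : 1 ≤ s) : 0 ≤ H s := by
    by_contra! hneg
    obtain ⟨S, hS⟩ := exists_forall_exp_neg_lt (a := 1 / 2) (by norm_num)
      (show 0 < -H s / 2 by linarith) (3 * K)
    obtain ⟨t, ht, hEt⟩ := small (-H s / 8) (by linarith) (max S s) (hs.trans (le_max_right _ _))
    have hst : s ≤ t := (le_max_right _ _).trans ht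
    have h1 := Hanti (mem_Ici.2 hs) (mem_Ici.2 (hs.trans hst)) hst
    have h2 := hS t ((le_max_left _ _).trans ht)
    have h3 := Hge t (hs.trans hst)
    linarith
  -- The rate `1/32` spends half of the dissipation: `H' + H/32 ≤ -E/8` plus an error that the last
  -- term absorbs. Thus the decrease of `G` pays for the energy with weight `e^{s/32}`.
  set G : ℝ → ℝ := fun s => H s * Real.exp (1 / 32 * s) + K * Real.exp (-(15 / 32 * s)) with hG
  set G' : ℝ → ℝ := fun s => H' s * Real.exp (1 / 32 * s) + H s * (1 / 32 * Real.exp (1 / 32 * s))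
    + K * (-(15 / 32) * Real.exp (-(15 / 32 * s))) with hG'
  have dG (s : ℝ) (hs : 1 ≤ s) : HasDerivAt G (G' s) s :=
    ((dH s hs).mul (dexp _ s)).add ((dexpn _ s).const_mul _)
  have Gnonneg (s : ℝ) (hs : 1 ≤ s) : 0 ≤ G s := by
    have := Hnonneg s hs
    simp only [hG]; positivity
  have G'le (s : ℝ) (hs : 1 ≤ s) : G' s ≤ -(1 / 8 * (Real.exp (1 / 32 * s) * E s)) := by
    have h1 := H'le s hs
    have h2 := Hle s hs
    have h3 : Real.exp (1 / 32 * s) * Real.exp (-(1 / 2 * s)) = Real.exp (-(15 / 32 * s)) := by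
      rw [← Real.exp_add]; ring_nf
    have h4 : H' s + 1 / 32 * H s ≤ -(1 / 8 * E s) + 3 / 32 * K * Real.exp (-(1 / 2 * s)) := by
      linarith
    have h5 := mul_le_mul_of_nonneg_left h4 (Real.exp_pos (1 / 32 * s)).le
    have h6 : Real.exp (1 / 32 * s) * (-(1 / 8 * E s) + 3 / 32 * K * Real.exp (-(1 / 2 * s)))
        = -(1 / 8 * (Real.exp (1 / 32 * s) * E s)) + 3 / 32 * K * Real.exp (-(15 / 32 * s)) := by
      rw [← h3]; ring
    have h7 : 0 ≤ K * Real.exp (-(15 / 32 * s)) := by positivity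
    simp only [hG']
    linarith
  have Ganti : AntitoneOn G (Ici 1) := antitoneOn_Ici_of_hasDerivAt dG fun s hs => by
    have h1 := G'le s hs
    have h2 := hE s hs
    have : 0 ≤ Real.exp (1 / 32 * s) * E s := by positivity
    linarith
  -- The factors 8 and 64 are chosen so that `G'` yields `-K e^{s/64} E` and the exponential yields
  -- `-K e^{-s/64}`, the two parts of the bound for `Ψ'`.
  set N : ℝ → ℝ := fun s => (8 * K * G s + 64 * K) * Real.exp (-(1 / 64 * s)) - Ψ s with hN
  have Nanti : AntitoneOn N (Ici 1) := by
    refine antitoneOn_Ici_of_hasDerivAt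
      (f' := fun s => 8 * K * G' s * Real.exp (-(1 / 64 * s)) +
        (8 * K * G s + 64 * K) * (-(1 / 64) * Real.exp (-(1 / 64 * s))) - Ψ' s)
      (fun s hs => ((((dG s hs).const_mul _).add_const _).mul (dexpn _ s)).sub (hΨ s hs))
      fun s hs => ?_
    have h1 := G'le s hs
    have h2 := Gnonneg s hs
    have h3 := (abs_le.1 (hΨ' s hs)).1
    have h4 : Real.exp (-(1 / 64 * s)) * Real.exp (1 / 32 * s) = Real.exp (1 / 64 * s) := by
      rw [← Real.exp_add]; ring_nf
    have h5 := mul_le_mul_of_nonneg_left h1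
      (show 0 ≤ 8 * K * Real.exp (-(1 / 64 * s)) by positivity)
    have h6 : 8 * K * Real.exp (-(1 / 64 * s)) * -(1 / 8 * (Real.exp (1 / 32 * s) * E s))
        = -(K * (Real.exp (1 / 64 * s) * E s)) := by rw [← h4]; ring
    have h7 : 0 ≤ K * G s * Real.exp (-(1 / 64 * s)) := by positivity
    linarith
  refine ⟨8 * K * G 1 + 64 * K, fun s hs => ?_⟩
  -- `N` decreases, and at late times of small energy `Ψ` is small, so `N` cannot be below a fixed
  -- negative number.
  have hNs : 0 ≤ N s := by
    by_contra! hneg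
    obtain ⟨δ, hδ, S, hS⟩ := hΨE (-N s) (by linarith)
    obtain ⟨t, ht, hEt⟩ := small δ hδ (max S s) (hs.trans (le_max_right _ _))
    have hst : s ≤ t := (le_max_right _ _).trans ht
    have h1 := Nanti (mem_Ici.2 hs) (mem_Ici.2 (hs.trans hst)) hst
    have h2 := hS t ((le_max_left _ _).trans ht) hEt
    have h3 : 0 ≤ (8 * K * G t + 64 * K) * Real.exp (-(1 / 64 * t)) := by
      have := Gnonneg t (hs.trans hst)
      positivity
    simp only [hN] at h1 h2 hneg
    linarith
  have hGs := Ganti (mem_Ici.2 le_rfl) (mem_Ici.2 hs) hs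
  have : (8 * K * G s + 64 * K) * Real.exp (-(1 / 64 * s))
      ≤ (8 * K * G 1 + 64 * K) * Real.exp (-(1 / 64 * s)) := by gcongr
  simp only [hN] at hNs
  linarith

/-! ### Sheets in log-polar coordinates and the Jacobian of the gradient map -/

/-- The domain of a `3`-valued graph in the coordinates `(log ρ, θ)`. -/
def logDomain : Set (ℝ × ℝ) := Ioi 0 ×ˢ Ioo (-(3 * Real.pi)) (3 * Real.pi)

theorem isOpen_logDomain : IsOpen logDomain := isOpen_Ioi.prod isOpen_Ioo

/-- A sheet in the coordinates `(s, t) = (log ρ, θ)`: the height is `v`, the Cartesian components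
of its gradient are `p` and `q`. -/
structure LogPolarSheet (ε C₂ : ℝ) (v p q : ℝ × ℝ → ℝ) : Prop where
  eps_nonneg : 0 ≤ ε
  smooth_v : ContDiffOn ℝ ∞ v logDomain
  smooth_p : ContDiffOn ℝ ∞ p logDomain
  smooth_q : ContDiffOn ℝ ∞ q logDomain
  pd1_v : ∀ s t, (s, t) ∈ logDomain →
    pd1 v (s, t) = Real.exp s * (Real.cos t * p (s, t) + Real.sin t * q (s, t))
  pd2_v : ∀ s t, (s, t) ∈ logDomain →
    pd2 v (s, t) = Real.exp s * (-Real.sin t * p (s, t) + Real.cos t * q (s, t))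
  grad_le : ∀ s t, (s, t) ∈ logDomain → p (s, t) ^ 2 + q (s, t) ^ 2 ≤ ε ^ 2
  minimal : ∀ s t, (s, t) ∈ logDomain →
    (1 + q (s, t) ^ 2) * (Real.cos t * pd1 p (s, t) - Real.sin t * pd2 p (s, t))
      - p (s, t) * q (s, t) * (Real.cos t * pd1 q (s, t) - Real.sin t * pd2 q (s, t))
      - p (s, t) * q (s, t) * (Real.sin t * pd1 p (s, t) + Real.cos t * pd2 p (s, t))
      + (1 + p (s, t) ^ 2) * (Real.sin t * pd1 q (s, t) + Real.cos t * pd2 q (s, t)) = 0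
  hess_le : ∀ s t, (s, t) ∈ logDomain →
    pd1 p (s, t) ^ 2 + pd2 p (s, t) ^ 2 + pd1 q (s, t) ^ 2 + pd2 q (s, t) ^ 2 ≤ (2 * ε) ^ 2
  jump_p : ∀ s t, 0 < s → t ∈ Ioo (-(3 * Real.pi)) Real.pi →
    |p (s, t + 2 * Real.pi) - p (s, t)| ≤ Real.exp (-(1 / 2 * s))
  jump_q : ∀ s t, 0 < s → t ∈ Ioo (-(3 * Real.pi)) Real.pi →
    |q (s, t + 2 * Real.pi) - q (s, t)| ≤ Real.exp (-(1 / 2 * s))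
  jump_pd1_q : ∀ s t, 0 < s → t ∈ Ioo (-(3 * Real.pi)) Real.pi →
    |pd1 q (s, t + 2 * Real.pi) - pd1 q (s, t)| ≤ Real.exp (-(1 / 2 * s))
  abs_v_le : ∀ s t, (s, t) ∈ logDomain → |v (s, t)| ≤ ε * Real.exp s
  le_sep : ∀ s t, 0 < s → t ∈ Ioo (-(3 * Real.pi)) Real.pi →
    C₂ * Real.exp (-(ε / 4 * s)) ≤ v (s, t + 2 * Real.pi) - v (s, t)
  C₂_le : C₂ ≤ 2 * ε
  tendsto_p : Tendsto (fun s => p (s, 0)) atTop (𝓝 0)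
  tendsto_q : Tendsto (fun s => q (s, 0)) atTop (𝓝 0)

/-- The range of `a` is the one attained by `a = t₀ - π` with `t₀ ∈ [-π, π]`. It makes every window
contain the angle `0`, on which the gradient is known to tend to zero. -/
theorem mem_logDomain_of_window {a s t : ℝ} (ha : a ∈ Icc (-(2 * Real.pi)) 0) (hs : 0 < s)
    (ht : t ∈ Icc a (a + 2 * Real.pi)) : (s, t) ∈ logDomain := by
  have := Real.pi_pos
  exact ⟨hs, by linarith [ha.1, ht.1], by linarith [ha.2, ht.2]⟩

theorem continuousOn_window {k : ℝ × ℝ → ℝ} (hk : ContinuousOn k logDomain) {a s : ℝ}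
    (ha : a ∈ Icc (-(2 * Real.pi)) 0) (hs : 0 < s) :
    ContinuousOn (fun t => k (s, t)) (Icc a (a + 2 * Real.pi)) :=
  hk.comp (by fun_prop) fun _ ht => mem_logDomain_of_window ha hs ht

theorem intervalIntegrable_window {k : ℝ × ℝ → ℝ} (hk : ContinuousOn k logDomain) {a s : ℝ}
    (ha : a ∈ Icc (-(2 * Real.pi)) 0) (hs : 0 < s) :
    IntervalIntegrable (fun t => k (s, t)) volume a (a + 2 * Real.pi) := by
  apply ContinuousOn.intervalIntegrable
  rw [uIcc_of_le (by linarith [Real.pi_pos])]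
  exact continuousOn_window hk ha hs

/-- The variation over a window is bounded by the integral of the angular derivative. -/
theorem abs_sub_le_window {k : ℝ × ℝ → ℝ} (hk : ContDiffOn ℝ ∞ k logDomain) {a s t t' : ℝ}
    (ha : a ∈ Icc (-(2 * Real.pi)) 0) (hs : 0 < s) (ht : t ∈ Icc a (a + 2 * Real.pi))
    (ht' : t' ∈ Icc a (a + 2 * Real.pi)) :
    |k (s, t) - k (s, t')| ≤ ∫ r in a..(a + 2 * Real.pi), |pd2 k (s, r)| := by
  have hab : a ≤ a + 2 * Real.pi := by linarith [Real.pi_pos]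
  wlog h : t' ≤ t generalizing t t'
  · rw [abs_sub_comm]
    exact this ht' ht (le_of_not_ge h)
  have hc : ContinuousOn (pd2 k) logDomain := (contDiffOn_pd2 isOpen_logDomain hk).continuousOn
  have hi := intervalIntegrable_window hc ha hs
  have hsub : uIcc t' t ⊆ uIcc a (a + 2 * Real.pi) := by
    rw [uIcc_of_le h, uIcc_of_le hab]; exact Icc_subset_Icc ht'.1 ht.2
  have hftc : ∫ r in t'..t, pd2 k (s, r) = k (s, t) - k (s, t') := by
    refine intervalIntegral.integral_eq_sub_of_hasDerivAt (f := fun r => k (s, r))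
      (fun r hr => ?_) (hi.mono_set hsub)
    have hr' : r ∈ Icc a (a + 2 * Real.pi) := by
      have := hsub hr; rwa [uIcc_of_le hab] at this
    exact hasDerivAt_snd (differentiableAt_of_contDiffOn isOpen_logDomain hk
      (mem_logDomain_of_window ha hs hr'))
  rw [← hftc]
  refine (intervalIntegral.abs_integral_le_integral_abs h).trans ?_
  exact intervalIntegral.integral_mono_interval ht'.1 h ht.2
    (Eventually.of_forall fun r => abs_nonneg _) hi.abs

namespace LogPolarSheet

variable {ε C₂ : ℝ} {v p q : ℝ × ℝ → ℝ}

theorem differentiableAt_p (h : LogPolarSheet ε C₂ v p q) {z : ℝ × ℝ} (hz : z ∈ logDomain) :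
    DifferentiableAt ℝ p z := differentiableAt_of_contDiffOn isOpen_logDomain h.smooth_p hz

theorem differentiableAt_q (h : LogPolarSheet ε C₂ v p q) {z : ℝ × ℝ} (hz : z ∈ logDomain) :
    DifferentiableAt ℝ q z := differentiableAt_of_contDiffOn isOpen_logDomain h.smooth_q hz

theorem differentiableAt_v (h : LogPolarSheet ε C₂ v p q) {z : ℝ × ℝ} (hz : z ∈ logDomain) :
    DifferentiableAt ℝ v z := differentiableAt_of_contDiffOn isOpen_logDomain h.smooth_v hz

theorem eventually_fst_mem {s t : ℝ} (hz : (s, t) ∈ logDomain) :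
    ∀ᶠ r in 𝓝 s, (r, t) ∈ logDomain :=
  (Continuous.prodMk_left t).continuousAt.eventually (isOpen_logDomain.mem_nhds hz)

theorem eventually_snd_mem {s t : ℝ} (hz : (s, t) ∈ logDomain) :
    ∀ᶠ r in 𝓝 t, (s, r) ∈ logDomain :=
  (Continuous.prodMk_right s).continuousAt.eventually (isOpen_logDomain.mem_nhds hz)

theorem pd1_pd1_v (h : LogPolarSheet ε C₂ v p q) {s t : ℝ} (hz : (s, t) ∈ logDomain) :
    pd1 (pd1 v) (s, t) = pd1 v (s, t)
      + Real.exp s * (Real.cos t * pd1 p (s, t) + Real.sin t * pd1 q (s, t)) := by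
  refine pd1_eq_of_hasDerivAt (differentiableAt_of_contDiffOn isOpen_logDomain
    (contDiffOn_pd1 isOpen_logDomain h.smooth_v) hz) ?_
  have := (Real.hasDerivAt_exp s).mul
    (((hasDerivAt_fst (h.differentiableAt_p hz)).const_mul (Real.cos t)).add
      ((hasDerivAt_fst (h.differentiableAt_q hz)).const_mul (Real.sin t)))
  rw [h.pd1_v s t hz]
  refine this.congr_of_eventuallyEq ?_
  filter_upwards [eventually_fst_mem hz] with r hr using h.pd1_v r t hr

theorem pd1_pd2_v (h : LogPolarSheet ε C₂ v p q) {s t : ℝ} (hz : (s, t) ∈ logDomain) :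
    pd1 (pd2 v) (s, t) = pd2 v (s, t)
      + Real.exp s * (-Real.sin t * pd1 p (s, t) + Real.cos t * pd1 q (s, t)) := by
  refine pd1_eq_of_hasDerivAt (differentiableAt_of_contDiffOn isOpen_logDomain
    (contDiffOn_pd2 isOpen_logDomain h.smooth_v) hz) ?_
  have := (Real.hasDerivAt_exp s).mul
    (((hasDerivAt_fst (h.differentiableAt_p hz)).const_mul (-Real.sin t)).add
      ((hasDerivAt_fst (h.differentiableAt_q hz)).const_mul (Real.cos t)))
  rw [h.pd2_v s t hz]
  refine this.congr_of_eventuallyEq ?_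
  filter_upwards [eventually_fst_mem hz] with r hr using h.pd2_v r t hr

theorem pd2_pd1_v (h : LogPolarSheet ε C₂ v p q) {s t : ℝ} (hz : (s, t) ∈ logDomain) :
    pd2 (pd1 v) (s, t) = pd2 v (s, t)
      + Real.exp s * (Real.cos t * pd2 p (s, t) + Real.sin t * pd2 q (s, t)) := by
  refine pd2_eq_of_hasDerivAt (differentiableAt_of_contDiffOn isOpen_logDomain
    (contDiffOn_pd1 isOpen_logDomain h.smooth_v) hz) ?_
  have := (((Real.hasDerivAt_cos t).mul (hasDerivAt_snd (h.differentiableAt_p hz))).add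
      ((Real.hasDerivAt_sin t).mul (hasDerivAt_snd (h.differentiableAt_q hz)))).const_mul
      (Real.exp s)
  rw [h.pd2_v s t hz]
  refine (this.congr_of_eventuallyEq ?_).congr_deriv (by ring)
  filter_upwards [eventually_snd_mem hz] with r hr using h.pd1_v s r hr

theorem pd2_pd2_v (h : LogPolarSheet ε C₂ v p q) {s t : ℝ} (hz : (s, t) ∈ logDomain) :
    pd2 (pd2 v) (s, t) = -pd1 v (s, t)
      + Real.exp s * (-Real.sin t * pd2 p (s, t) + Real.cos t * pd2 q (s, t)) := by
  refine pd2_eq_of_hasDerivAt (differentiableAt_of_contDiffOn isOpen_logDomain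
    (contDiffOn_pd2 isOpen_logDomain h.smooth_v) hz) ?_
  have := (((Real.hasDerivAt_sin t).neg.mul (hasDerivAt_snd (h.differentiableAt_p hz))).add
      ((Real.hasDerivAt_cos t).mul (hasDerivAt_snd (h.differentiableAt_q hz)))).const_mul
      (Real.exp s)
  rw [h.pd1_v s t hz]
  refine (this.congr_of_eventuallyEq ?_).congr_deriv (by rw [Pi.neg_apply]; ring)
  filter_upwards [eventually_snd_mem hz] with r hr using h.pd2_v s r hr

/-- Equality of the mixed derivatives of `v`, that is, symmetry of the Cartesian Hessian. -/
theorem curl (h : LogPolarSheet ε C₂ v p q) {s t : ℝ} (hz : (s, t) ∈ logDomain) :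
    Real.cos t * pd2 p (s, t) + Real.sin t * pd2 q (s, t)
      = -Real.sin t * pd1 p (s, t) + Real.cos t * pd1 q (s, t) := by
  have h1 := h.pd1_pd2_v hz
  rw [pd1_pd2_comm isOpen_logDomain h.smooth_v hz, h.pd2_pd1_v hz] at h1
  exact mul_left_cancel₀ (Real.exp_pos s).ne' (add_left_cancel h1)

/-- The Jacobian of the gradient map is negative, comparably to the energy density. -/
theorem jacobian_le (h : LogPolarSheet ε C₂ v p q) (hε : ε ≤ 1 / 2) {s t : ℝ}
    (hz : (s, t) ∈ logDomain) :
    pd1 p (s, t) * pd2 q (s, t) - pd2 p (s, t) * pd1 q (s, t) ≤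
      -(1 / 4 * (pd1 p (s, t) ^ 2 + pd2 p (s, t) ^ 2 + pd1 q (s, t) ^ 2 + pd2 q (s, t) ^ 2)) := by
  have hc := h.curl hz
  have hm := h.minimal s t hz
  have hg := h.grad_le s t hz
  have hε0 := h.eps_nonneg
  have hcs := Real.sin_sq_add_cos_sq t
  generalize Real.sin t = S at *
  generalize Real.cos t = c at *
  generalize p (s, t) = P at *
  generalize q (s, t) = Q at *
  generalize pd1 p (s, t) = ps at *
  generalize pd2 p (s, t) = pt at *
  generalize pd1 q (s, t) = qs at *
  generalize pd2 q (s, t) = qt at *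
  -- `X`, `Y`, `T` are `e^s` times `u_xx`, `u_xy`, `u_yy`; `curl` identifies the two mixed entries.
  set X := c * ps - S * pt with hX
  set Y := S * ps + c * pt with hY
  set T := S * qs + c * qt with hT
  have hZ : c * qs - S * qt = Y := by rw [hY]; linarith
  have e1 : ps * qt - pt * qs = X * T - Y * Y := by
    rw [← hZ]
    nth_rewrite 2 [hZ]
    rw [hX, hT, hY]
    linear_combination (-(ps * qt - pt * qs)) * hcs
  have e2 : ps ^ 2 + pt ^ 2 + qs ^ 2 + qt ^ 2 = X ^ 2 + Y ^ 2 + Y ^ 2 + T ^ 2 := by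
    nth_rewrite 2 [← hZ]
    rw [hX, hT, hY]
    linear_combination (-(ps ^ 2 + pt ^ 2 + qs ^ 2 + qt ^ 2)) * hcs
  rw [hZ] at hm
  -- The minimal surface equation makes the trace of the Hessian small relative to its norm, and `2
  -- det = (tr)² - |Hess|²` then forces a negative determinant.
  have e3 : X + T = -(Q ^ 2 * X - 2 * (P * Q) * Y + P ^ 2 * T) := by linarith
  have e4 : (Q ^ 2 * X - 2 * (P * Q) * Y + P ^ 2 * T) ^ 2
      ≤ (P ^ 2 + Q ^ 2) ^ 2 * (X ^ 2 + 2 * Y ^ 2 + T ^ 2) := by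
    rw [← sub_nonneg]
    have : (P ^ 2 + Q ^ 2) ^ 2 * (X ^ 2 + 2 * Y ^ 2 + T ^ 2)
        - (Q ^ 2 * X - 2 * (P * Q) * Y + P ^ 2 * T) ^ 2 = (Q ^ 2 * T - P ^ 2 * X) ^ 2
        + 2 * (Q ^ 2 * Y + P * Q * X) ^ 2 + 2 * (P ^ 2 * Y + P * Q * T) ^ 2 := by ring
    rw [this]
    positivity
  have e5 : (P ^ 2 + Q ^ 2) ^ 2 ≤ 1 / 2 := by
    have h1 : P ^ 2 + Q ^ 2 ≤ 1 / 2 := hg.trans (by nlinarith)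
    have h0 : 0 ≤ P ^ 2 + Q ^ 2 := by positivity
    generalize P ^ 2 + Q ^ 2 = x at h0 h1
    nlinarith
  have e6 : (X + T) ^ 2 ≤ 1 / 2 * (X ^ 2 + 2 * Y ^ 2 + T ^ 2) := by
    rw [e3, neg_sq]
    exact e4.trans (mul_le_mul_of_nonneg_right e5 (by positivity))
  have e7 : 2 * (X * T - Y * Y) = (X + T) ^ 2 - (X ^ 2 + 2 * Y ^ 2 + T ^ 2) := by ring
  rw [e1, e2]
  linarith

end LogPolarSheet

theorem hasDerivAt_integral_window {g g' : ℝ × ℝ → ℝ} (hg : ContinuousOn g logDomain)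
    (hg' : ContinuousOn g' logDomain) {a s : ℝ} (ha : a ∈ Icc (-(2 * Real.pi)) 0) (hs : 0 < s)
    (hd : ∀ r t, (r, t) ∈ logDomain → HasDerivAt (fun r => g (r, t)) (g' (r, t)) r) :
    HasDerivAt (fun r => ∫ t in a..(a + 2 * Real.pi), g (r, t))
      (∫ t in a..(a + 2 * Real.pi), g' (s, t)) s := by
  have hsub : Ioi (0 : ℝ) ×ˢ Icc a (a + 2 * Real.pi) ⊆ logDomain := fun z hz =>
    mem_logDomain_of_window ha hz.1 hz.2
  exact hasDerivAt_intervalIntegral_param (by linarith [Real.pi_pos]) isOpen_Ioi hs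
    (hg.mono hsub) (hg'.mono hsub) fun r hr t ht => hd r t (hsub ⟨hr, ht⟩)

theorem integral_window_mono {g k : ℝ × ℝ → ℝ} (hg : ContinuousOn g logDomain)
    (hk : ContinuousOn k logDomain) {a s : ℝ} (ha : a ∈ Icc (-(2 * Real.pi)) 0) (hs : 0 < s)
    (hle : ∀ t, (s, t) ∈ logDomain → g (s, t) ≤ k (s, t)) :
    ∫ t in a..(a + 2 * Real.pi), g (s, t) ≤ ∫ t in a..(a + 2 * Real.pi), k (s, t) :=
  intervalIntegral.integral_mono_on (by linarith [Real.pi_pos]) (intervalIntegrable_window hg ha hs)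
    (intervalIntegrable_window hk ha hs) fun t ht => hle t (mem_logDomain_of_window ha hs ht)

theorem integral_window_le_const {g : ℝ × ℝ → ℝ} (hg : ContinuousOn g logDomain) {a s C : ℝ}
    (ha : a ∈ Icc (-(2 * Real.pi)) 0) (hs : 0 < s)
    (hle : ∀ t ∈ Icc a (a + 2 * Real.pi), g (s, t) ≤ C) :
    ∫ t in a..(a + 2 * Real.pi), g (s, t) ≤ 2 * Real.pi * C := by
  have := intervalIntegral.integral_mono_on (by linarith [Real.pi_pos])
    (intervalIntegrable_window hg ha hs) intervalIntegrable_const hle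
  simpa using this

/-! ### Decay of the gradient in the mean and sublinear growth -/

namespace LogPolarSheet

variable {ε C₂ : ℝ} {v p q : ℝ × ℝ → ℝ}

/-- The Dirichlet energy density of the gradient map. -/
noncomputable def density (p q : ℝ × ℝ → ℝ) (z : ℝ × ℝ) : ℝ :=
  pd1 p z ^ 2 + pd2 p z ^ 2 + pd1 q z ^ 2 + pd2 q z ^ 2

theorem contDiffOn_pd1_p (h : LogPolarSheet ε C₂ v p q) : ContDiffOn ℝ ∞ (pd1 p) logDomain :=
  contDiffOn_pd1 isOpen_logDomain h.smooth_p

theorem contDiffOn_pd2_p (h : LogPolarSheet ε C₂ v p q) : ContDiffOn ℝ ∞ (pd2 p) logDomain :=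
  contDiffOn_pd2 isOpen_logDomain h.smooth_p

theorem contDiffOn_pd1_q (h : LogPolarSheet ε C₂ v p q) : ContDiffOn ℝ ∞ (pd1 q) logDomain :=
  contDiffOn_pd1 isOpen_logDomain h.smooth_q

theorem contDiffOn_pd2_q (h : LogPolarSheet ε C₂ v p q) : ContDiffOn ℝ ∞ (pd2 q) logDomain :=
  contDiffOn_pd2 isOpen_logDomain h.smooth_q

theorem continuousOn_density (h : LogPolarSheet ε C₂ v p q) :
    ContinuousOn (density p q) logDomain :=
  (((h.contDiffOn_pd1_p.continuousOn.pow 2).add (h.contDiffOn_pd2_p.continuousOn.pow 2)).add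
    (h.contDiffOn_pd1_q.continuousOn.pow 2)).add (h.contDiffOn_pd2_q.continuousOn.pow 2)

theorem abs_p_le (h : LogPolarSheet ε C₂ v p q) {s t : ℝ} (hz : (s, t) ∈ logDomain) :
    |p (s, t)| ≤ ε :=
  abs_le_of_sq_le_sq (by nlinarith [h.grad_le s t hz, sq_nonneg (q (s, t))]) h.eps_nonneg

theorem abs_q_le (h : LogPolarSheet ε C₂ v p q) {s t : ℝ} (hz : (s, t) ∈ logDomain) :
    |q (s, t)| ≤ ε :=
  abs_le_of_sq_le_sq (by nlinarith [h.grad_le s t hz, sq_nonneg (p (s, t))]) h.eps_nonneg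

theorem abs_pd1_q_le (h : LogPolarSheet ε C₂ v p q) {s t : ℝ} (hz : (s, t) ∈ logDomain) :
    |pd1 q (s, t)| ≤ 2 * ε := by
  refine abs_le_of_sq_le_sq ?_ (by linarith [h.eps_nonneg])
  nlinarith [h.hess_le s t hz, sq_nonneg (pd1 p (s, t)), sq_nonneg (pd2 p (s, t)),
    sq_nonneg (pd2 q (s, t))]

variable {a s : ℝ}

/-- The derivative of `∮ p dq`. -/
theorem hasDerivAt_action (h : LogPolarSheet ε C₂ v p q) (ha : a ∈ Icc (-(2 * Real.pi)) 0)
    (hs : 0 < s) :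
    HasDerivAt (fun r => ∫ t in a..(a + 2 * Real.pi), p (r, t) * pd2 q (r, t))
      ((∫ t in a..(a + 2 * Real.pi),
        (pd1 p (s, t) * pd2 q (s, t) - pd2 p (s, t) * pd1 q (s, t)))
        + (p (s, a + 2 * Real.pi) * pd1 q (s, a + 2 * Real.pi) - p (s, a) * pd1 q (s, a))) s := by
  have cp := h.smooth_p.continuousOn
  have cp1 := h.contDiffOn_pd1_p.continuousOn
  have cp2 := h.contDiffOn_pd2_p.continuousOn
  have cq1 := h.contDiffOn_pd1_q.continuousOn
  have cq2 := h.contDiffOn_pd2_q.continuousOn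
  have cq12 : ContinuousOn (pd1 (pd2 q)) logDomain :=
    (contDiffOn_pd1 isOpen_logDomain h.contDiffOn_pd2_q).continuousOn
  have hab : a ≤ a + 2 * Real.pi := by linarith [Real.pi_pos]
  have hder := hasDerivAt_integral_window (g := fun z => p z * pd2 q z)
    (g' := fun z => pd1 p z * pd2 q z + p z * pd1 (pd2 q) z) (cp.mul cq2)
    ((cp1.mul cq2).add (cp.mul cq12)) ha hs fun r t hz =>
      (hasDerivAt_fst (h.differentiableAt_p hz)).mul (hasDerivAt_fst
        (differentiableAt_of_contDiffOn isOpen_logDomain h.contDiffOn_pd2_q hz))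
  -- Integrating the `t`-derivative of `p q_s` trades `p q_st` for `-p_t q_s` and end terms, which
  -- leaves the Jacobian.
  have hftc : ∫ t in a..(a + 2 * Real.pi), (pd2 p (s, t) * pd1 q (s, t)
      + p (s, t) * pd1 (pd2 q) (s, t))
      = p (s, a + 2 * Real.pi) * pd1 q (s, a + 2 * Real.pi) - p (s, a) * pd1 q (s, a) := by
    refine intervalIntegral.integral_eq_sub_of_hasDerivAt (f := fun t => p (s, t) * pd1 q (s, t))
      (fun t ht => ?_)
      (intervalIntegrable_window (k := fun z => pd2 p z * pd1 q z + p z * pd1 (pd2 q) z)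
        ((cp2.mul cq1).add (cp.mul cq12)) ha hs)
    rw [uIcc_of_le hab] at ht
    have hz := mem_logDomain_of_window ha hs ht
    rw [pd1_pd2_comm isOpen_logDomain h.smooth_q hz]
    exact (hasDerivAt_snd (h.differentiableAt_p hz)).mul (hasDerivAt_snd
      (differentiableAt_of_contDiffOn isOpen_logDomain h.contDiffOn_pd1_q hz))
  refine hder.congr_deriv ?_
  rw [← hftc, ← intervalIntegral.integral_add
    (intervalIntegrable_window (k := fun z => pd1 p z * pd2 q z - pd2 p z * pd1 q z)
      ((cp1.mul cq2).sub (cp2.mul cq1)) ha hs)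
    (intervalIntegrable_window (k := fun z => pd2 p z * pd1 q z + p z * pd1 (pd2 q) z)
        ((cp2.mul cq1).add (cp.mul cq12)) ha hs)]
  congr 1; ext t; ring

theorem left_mem_window (a : ℝ) : a ∈ Icc a (a + 2 * Real.pi) :=
  ⟨le_rfl, by linarith [Real.pi_pos]⟩

theorem right_mem_window (a : ℝ) : a + 2 * Real.pi ∈ Icc a (a + 2 * Real.pi) :=
  ⟨by linarith [Real.pi_pos], le_rfl⟩

theorem mem_jump_range (ha : a ∈ Icc (-(2 * Real.pi)) 0) :
    a ∈ Ioo (-(3 * Real.pi)) Real.pi :=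
  ⟨by linarith [Real.pi_pos, ha.1], by linarith [Real.pi_pos, ha.2]⟩

theorem integral_density_nonneg (s : ℝ) :
    0 ≤ ∫ t in a..(a + 2 * Real.pi), density p q (s, t) :=
  intervalIntegral.integral_nonneg (by linarith [Real.pi_pos]) fun t _ => by
    unfold density; positivity

theorem integral_density_le (h : LogPolarSheet ε C₂ v p q) (ha : a ∈ Icc (-(2 * Real.pi)) 0)
    (hs : 0 < s) : ∫ t in a..(a + 2 * Real.pi), density p q (s, t) ≤ 2 * Real.pi * (2 * ε) ^ 2 :=
  integral_window_le_const h.continuousOn_density ha hs fun t ht =>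
    h.hess_le s t (mem_logDomain_of_window ha hs ht)

/-- On a closed loop the end terms would cancel. Here they differ by the jumps of `p` and `q_s` over
one turn, which costs the exponential error. -/
theorem deriv_action_le (h : LogPolarSheet ε C₂ v p q) (hε : ε ≤ 1 / 2)
    (ha : a ∈ Icc (-(2 * Real.pi)) 0) (hs : 0 < s) :
    (∫ t in a..(a + 2 * Real.pi), (pd1 p (s, t) * pd2 q (s, t) - pd2 p (s, t) * pd1 q (s, t)))
        + (p (s, a + 2 * Real.pi) * pd1 q (s, a + 2 * Real.pi) - p (s, a) * pd1 q (s, a))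
      ≤ -(1 / 4 * ∫ t in a..(a + 2 * Real.pi), density p q (s, t))
        + 2 * Real.exp (-(1 / 2 * s)) := by
  have h1 := integral_window_mono
    (g := fun z => pd1 p z * pd2 q z - pd2 p z * pd1 q z)
    (k := fun z => -(1 / 4) * density p q z)
    ((h.contDiffOn_pd1_p.continuousOn.mul h.contDiffOn_pd2_q.continuousOn).sub
      (h.contDiffOn_pd2_p.continuousOn.mul h.contDiffOn_pd1_q.continuousOn))
    (continuousOn_const.mul h.continuousOn_density) ha hs fun t hz => by
      have := h.jacobian_le hε hz
      simp only [density]; linarith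
  rw [intervalIntegral.integral_const_mul] at h1
  have hj1 := h.jump_pd1_q s a hs (mem_jump_range ha)
  have hj2 := h.jump_p s a hs (mem_jump_range ha)
  have hp := h.abs_p_le (mem_logDomain_of_window ha hs (right_mem_window a))
  have hq := h.abs_pd1_q_le (mem_logDomain_of_window ha hs (left_mem_window a))
  have e : p (s, a + 2 * Real.pi) * pd1 q (s, a + 2 * Real.pi) - p (s, a) * pd1 q (s, a)
      = p (s, a + 2 * Real.pi) * (pd1 q (s, a + 2 * Real.pi) - pd1 q (s, a))
        + (p (s, a + 2 * Real.pi) - p (s, a)) * pd1 q (s, a) := by ring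
  have b1 : p (s, a + 2 * Real.pi) * (pd1 q (s, a + 2 * Real.pi) - pd1 q (s, a))
      ≤ 1 / 2 * Real.exp (-(1 / 2 * s)) := by
    refine (le_abs_self _).trans ?_
    rw [abs_mul]
    exact mul_le_mul (hp.trans hε) hj1 (abs_nonneg _) (by norm_num)
  have b2 : (p (s, a + 2 * Real.pi) - p (s, a)) * pd1 q (s, a)
      ≤ Real.exp (-(1 / 2 * s)) * 1 := by
    refine (le_abs_self _).trans ?_
    rw [abs_mul]
    exact mul_le_mul hj2 (by linarith) (abs_nonneg _) (Real.exp_pos _).le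
  rw [e]
  have := Real.exp_pos (-(1 / 2 * s))
  linarith

theorem integral_sq_pd2_add_le (h : LogPolarSheet ε C₂ v p q) (ha : a ∈ Icc (-(2 * Real.pi)) 0)
    (hs : 0 < s) :
    (∫ t in a..(a + 2 * Real.pi), |pd2 p (s, t)|) ^ 2
      + (∫ t in a..(a + 2 * Real.pi), |pd2 q (s, t)|) ^ 2
      ≤ 2 * Real.pi * ∫ t in a..(a + 2 * Real.pi), density p q (s, t) := by
  have hπ := Real.pi_pos
  have hab : a < a + 2 * Real.pi := by linarith
  have c1 := h.contDiffOn_pd2_p.continuousOn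
  have c2 := h.contDiffOn_pd2_q.continuousOn
  have h1 := sq_integral_abs_le hab (continuousOn_window c1 ha hs)
  have h2 := sq_integral_abs_le hab (continuousOn_window c2 ha hs)
  have h3 := integral_window_mono (g := fun z => pd2 p z ^ 2 + pd2 q z ^ 2) (k := density p q)
    ((c1.pow 2).add (c2.pow 2)) h.continuousOn_density ha hs fun t _ => by
      simp only [density]
      nlinarith [sq_nonneg (pd1 p (s, t)), sq_nonneg (pd1 q (s, t))]
  rw [intervalIntegral.integral_add
    (intervalIntegrable_window (k := fun z => pd2 p z ^ 2) (c1.pow 2) ha hs)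
    (intervalIntegrable_window (k := fun z => pd2 q z ^ 2) (c2.pow 2) ha hs)] at h3
  have e : a + 2 * Real.pi - a = 2 * Real.pi := by ring
  rw [e] at h1 h2
  have := mul_le_mul_of_nonneg_left h3 (show 0 ≤ 2 * Real.pi by positivity)
  linarith

/-- An isoperimetric inequality: replacing `p` by `p - p (s, a)` changes the integral only by a jump
of `q`, and the rest is at most `∫|p_t| ∫|q_t|`. By Cauchy–Schwarz this is at most `π` times the
energy, and `π < 4`. -/
theorem abs_action_le (h : LogPolarSheet ε C₂ v p q) (hε : ε ≤ 1 / 2)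
    (ha : a ∈ Icc (-(2 * Real.pi)) 0) (hs : 0 < s) :
    |∫ t in a..(a + 2 * Real.pi), p (s, t) * pd2 q (s, t)|
      ≤ 4 * (∫ t in a..(a + 2 * Real.pi), density p q (s, t)) + Real.exp (-(1 / 2 * s)) := by
  have hπ := Real.pi_pos
  have hab : a ≤ a + 2 * Real.pi := by linarith
  have cp := h.smooth_p.continuousOn
  have c2 := h.contDiffOn_pd2_q.continuousOn
  have hC := h.integral_sq_pd2_add_le ha hs
  set X := ∫ t in a..(a + 2 * Real.pi), |pd2 p (s, t)| with hX
  set Y := ∫ t in a..(a + 2 * Real.pi), |pd2 q (s, t)| with hY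
  have i2 : IntervalIntegrable (fun t => pd2 q (s, t)) volume a (a + 2 * Real.pi) :=
    intervalIntegrable_window c2 ha hs
  have i1 : IntervalIntegrable (fun t => (p (s, t) - p (s, a)) * pd2 q (s, t)) volume a
      (a + 2 * Real.pi) := by
    apply ContinuousOn.intervalIntegrable
    rw [uIcc_of_le hab]
    exact ((continuousOn_window cp ha hs).sub continuousOn_const).mul (continuousOn_window c2 ha hs)
  have hftc : ∫ t in a..(a + 2 * Real.pi), pd2 q (s, t) = q (s, a + 2 * Real.pi) - q (s, a) := by
    refine intervalIntegral.integral_eq_sub_of_hasDerivAt (f := fun t => q (s, t))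
      (fun t ht => ?_) i2
    rw [uIcc_of_le hab] at ht
    exact hasDerivAt_snd (h.differentiableAt_q (mem_logDomain_of_window ha hs ht))
  have e : ∫ t in a..(a + 2 * Real.pi), p (s, t) * pd2 q (s, t)
      = (∫ t in a..(a + 2 * Real.pi), (p (s, t) - p (s, a)) * pd2 q (s, t))
        + p (s, a) * (q (s, a + 2 * Real.pi) - q (s, a)) := by
    rw [← hftc, ← intervalIntegral.integral_const_mul,
      ← intervalIntegral.integral_add i1 (i2.const_mul _)]
    congr 1; ext t; ring
  have b1 : |∫ t in a..(a + 2 * Real.pi), (p (s, t) - p (s, a)) * pd2 q (s, t)| ≤ X * Y := by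
    refine (intervalIntegral.abs_integral_le_integral_abs hab).trans ?_
    rw [hY, ← intervalIntegral.integral_const_mul]
    refine intervalIntegral.integral_mono_on hab i1.abs (i2.abs.const_mul _) fun t ht => ?_
    rw [abs_mul]
    exact mul_le_mul_of_nonneg_right
      (abs_sub_le_window h.smooth_p ha hs ht (left_mem_window a)) (abs_nonneg _)
  have b2 : |p (s, a) * (q (s, a + 2 * Real.pi) - q (s, a))| ≤ Real.exp (-(1 / 2 * s)) := by
    rw [abs_mul]
    have := h.abs_p_le (mem_logDomain_of_window ha hs (left_mem_window a))
    calc _ ≤ 1 * Real.exp (-(1 / 2 * s)) :=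
          mul_le_mul (by linarith) (h.jump_q s a hs (mem_jump_range ha)) (abs_nonneg _) zero_le_one
      _ = _ := one_mul _
  rw [e]
  refine (abs_add_le _ _).trans (add_le_add (b1.trans ?_) b2)
  have hE := integral_density_nonneg (p := p) (q := q) (a := a) s
  have h4 := Real.pi_lt_four
  nlinarith [sq_nonneg (X - Y)]

theorem hasDerivAt_mass (h : LogPolarSheet ε C₂ v p q) (ha : a ∈ Icc (-(2 * Real.pi)) 0)
    (hs : 0 < s) :
    HasDerivAt (fun r => ∫ t in a..(a + 2 * Real.pi), (p (r, t) ^ 2 + q (r, t) ^ 2))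
      (∫ t in a..(a + 2 * Real.pi),
        2 * (p (s, t) * pd1 p (s, t) + q (s, t) * pd1 q (s, t))) s := by
  have cp := h.smooth_p.continuousOn
  have cq := h.smooth_q.continuousOn
  refine hasDerivAt_integral_window (g := fun z => p z ^ 2 + q z ^ 2)
    (g' := fun z => 2 * (p z * pd1 p z + q z * pd1 q z)) ((cp.pow 2).add (cq.pow 2))
    (continuousOn_const.mul ((cp.mul h.contDiffOn_pd1_p.continuousOn).add
      (cq.mul h.contDiffOn_pd1_q.continuousOn))) ha hs fun r t hz => ?_
  refine (((hasDerivAt_fst (h.differentiableAt_p hz)).pow 2).add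
    ((hasDerivAt_fst (h.differentiableAt_q hz)).pow 2)).congr_deriv ?_
  push_cast; ring

/-- The gradient is bounded, so AM–GM with weight `e^{s/64}` splits the integrand into weighted
energy and a decaying remainder, the shape required by `exists_le_exp_of_energy`. -/
theorem abs_deriv_mass_le (h : LogPolarSheet ε C₂ v p q) (hε : ε ≤ 1 / 2)
    (ha : a ∈ Icc (-(2 * Real.pi)) 0) (hs : 0 < s) :
    |∫ t in a..(a + 2 * Real.pi), 2 * (p (s, t) * pd1 p (s, t) + q (s, t) * pd1 q (s, t))|
      ≤ 200 * (Real.exp (1 / 64 * s) * (∫ t in a..(a + 2 * Real.pi), density p q (s, t))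
        + Real.exp (-(1 / 64 * s))) := by
  have hπ := Real.pi_pos
  have hab : a ≤ a + 2 * Real.pi := by linarith
  have cp := h.smooth_p.continuousOn
  have cq := h.smooth_q.continuousOn
  have i1 := intervalIntegrable_window (k := fun z => 2 * (p z * pd1 p z + q z * pd1 q z))
    (continuousOn_const.mul ((cp.mul h.contDiffOn_pd1_p.continuousOn).add
      (cq.mul h.contDiffOn_pd1_q.continuousOn))) ha hs
  have i2 := intervalIntegrable_window h.continuousOn_density ha hs
  refine (intervalIntegral.abs_integral_le_integral_abs hab).trans ?_
  have key : ∫ t in a..(a + 2 * Real.pi),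
      |2 * (p (s, t) * pd1 p (s, t) + q (s, t) * pd1 q (s, t))|
      ≤ ∫ t in a..(a + 2 * Real.pi),
        (Real.exp (1 / 64 * s) * density p q (s, t) + 2 * Real.exp (-(1 / 64 * s))) := by
    refine intervalIntegral.integral_mono_on hab i1.abs
      ((i2.const_mul _).add intervalIntegrable_const) fun t ht => ?_
    have hz := mem_logDomain_of_window ha hs ht
    have hl := Real.exp_pos (1 / 64 * s)
    have hm : Real.exp (1 / 64 * s) * Real.exp (-(1 / 64 * s)) = 1 := by
      rw [← Real.exp_add]; simp
    set l := Real.exp (1 / 64 * s)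
    set m := Real.exp (-(1 / 64 * s))
    have hm0 : 0 < m := Real.exp_pos _
    have amgm (x y : ℝ) (hx : |x| ≤ ε) : |2 * (x * y)| ≤ l * y ^ 2 + m := by
      rw [abs_mul, abs_mul, abs_two]
      have h1 : |x| * |y| ≤ 1 / 2 * |y| :=
        mul_le_mul_of_nonneg_right (hx.trans hε) (abs_nonneg _)
      have h2 : |y| = |y| * (l * m) := by rw [hm, mul_one]
      have h3 : l * (|y| - m) ^ 2 = l * |y| ^ 2 - 2 * (|y| * (l * m)) + m * (l * m) := by ring
      have h4 : 0 ≤ l * (|y| - m) ^ 2 := by positivity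
      rw [hm, mul_one, mul_one, sq_abs] at h3
      have := abs_nonneg y
      linarith
    have b1 := amgm _ (pd1 p (s, t)) (h.abs_p_le hz)
    have b2 := amgm _ (pd1 q (s, t)) (h.abs_q_le hz)
    rw [mul_add]
    refine (abs_add_le _ _).trans ?_
    have h5 : 0 ≤ l * (pd2 p (s, t) ^ 2 + pd2 q (s, t) ^ 2) := by positivity
    simp only [density]
    linarith
  refine key.trans ?_
  rw [intervalIntegral.integral_add (i2.const_mul _) intervalIntegrable_const,
    intervalIntegral.integral_const_mul, intervalIntegral.integral_const, smul_eq_mul]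
  have hE := integral_density_nonneg (p := p) (q := q) (a := a) s
  have h4 := Real.pi_lt_four
  have h5 : 0 ≤ Real.exp (1 / 64 * s) * ∫ t in a..(a + 2 * Real.pi), density p q (s, t) := by
    positivity
  have h6 := Real.exp_pos (-(1 / 64 * s))
  nlinarith

/-- Small energy bounds the oscillation of `p` and `q` over the window, and their values at the
angle `0` tend to zero. This is where the limit of the gradient enters. -/
theorem mass_small (h : LogPolarSheet ε C₂ v p q) (ha : a ∈ Icc (-(2 * Real.pi)) 0) {η : ℝ}
    (hη : 0 < η) : ∃ δ > 0, ∃ S, ∀ s, S ≤ s →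
      (∫ t in a..(a + 2 * Real.pi), density p q (s, t)) < δ →
      ∫ t in a..(a + 2 * Real.pi), (p (s, t) ^ 2 + q (s, t) ^ 2) < η := by
  have hπ := Real.pi_pos
  have h4 := Real.pi_lt_four
  have cp := h.smooth_p.continuousOn
  have cq := h.smooth_q.continuousOn
  have hlim : Tendsto (fun s => p (s, 0) ^ 2 + q (s, 0) ^ 2) atTop (𝓝 0) := by
    simpa using (h.tendsto_p.pow 2).add (h.tendsto_q.pow 2)
  obtain ⟨S, hS⟩ := eventually_atTop.1 (hlim.eventually (gt_mem_nhds (show 0 < η / 100 by linarith)))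
  refine ⟨η / 1000, by positivity, max S 1, fun s hs hE => ?_⟩
  have hs0 : 0 < s := lt_of_lt_of_le one_pos ((le_max_right _ _).trans hs)
  have h0 := hS s ((le_max_left _ _).trans hs)
  have h0w : (0 : ℝ) ∈ Icc a (a + 2 * Real.pi) := ⟨ha.2, by linarith [ha.1]⟩
  have hC := h.integral_sq_pd2_add_le ha hs0
  have hE0 := integral_density_nonneg (p := p) (q := q) (a := a) s
  refine (integral_window_le_const (g := fun z => p z ^ 2 + q z ^ 2)
    (C := 2 * (η / 100) + 2 * (8 * (η / 1000))) ((cp.pow 2).add (cq.pow 2)) ha hs0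
    fun t ht => ?_).trans_lt ?_
  · have b (x y X : ℝ) (hxy : |x - y| ≤ X) : x ^ 2 ≤ 2 * y ^ 2 + 2 * X ^ 2 := by
      have := sq_le_sq' (neg_le_of_abs_le hxy) (le_of_abs_le hxy)
      nlinarith [sq_nonneg (x - 2 * y)]
    have b1 := b _ _ _ (abs_sub_le_window h.smooth_p ha hs0 ht h0w)
    have b2 := b _ _ _ (abs_sub_le_window h.smooth_q ha hs0 ht h0w)
    have : 2 * Real.pi * (∫ t in a..(a + 2 * Real.pi), density p q (s, t)) ≤ 8 * (η / 1000) :=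
      mul_le_mul (by linarith) hE.le hE0 (by norm_num)
    linarith
  · nlinarith

/-- The gradient decays in the mean. -/
theorem exists_mass_le (h : LogPolarSheet ε C₂ v p q) (hε : ε ≤ 1 / 2)
    (ha : a ∈ Icc (-(2 * Real.pi)) 0) :
    ∃ C, ∀ s, 1 ≤ s → ∫ t in a..(a + 2 * Real.pi), (p (s, t) ^ 2 + q (s, t) ^ 2)
      ≤ C * Real.exp (-(1 / 64 * s)) := by
  have hpos {s : ℝ} (hs : 1 ≤ s) : 0 < s := one_pos.trans_le hs
  refine exists_le_exp_of_energy (K := 200) (by norm_num)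
    (B := fun r => ∫ t in a..(a + 2 * Real.pi), p (r, t) * pd2 q (r, t))
    (E := fun r => ∫ t in a..(a + 2 * Real.pi), density p q (r, t))
    (fun s hs => h.hasDerivAt_action ha (hpos hs)) (fun s hs => h.hasDerivAt_mass ha (hpos hs))
    (fun s hs => ?_) (fun s hs => ?_) (fun s hs => integral_density_nonneg s) (fun s hs => ?_)
    (fun s hs => h.abs_deriv_mass_le hε ha (hpos hs)) fun η hη => h.mass_small ha hη
  · have := h.deriv_action_le hε ha (hpos hs)
    have := Real.exp_pos (-(1 / 2 * s))
    linarith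
  · have := h.abs_action_le hε ha (hpos hs)
    have := Real.exp_pos (-(1 / 2 * s))
    linarith
  · have h1 := (abs_le.1 (h.abs_action_le hε ha (hpos hs))).1
    have h2 := h.integral_density_le ha (hpos hs)
    have h3 : Real.exp (-(1 / 2 * s)) ≤ 1 := Real.exp_le_one_iff.2 (by linarith)
    have h4 := Real.pi_lt_four
    have h5 := h.eps_nonneg
    have h6 : (2 * ε) ^ 2 ≤ 1 := by nlinarith
    have h7 : 2 * Real.pi * (2 * ε) ^ 2 ≤ 8 * 1 :=
      mul_le_mul (by linarith) h6 (by positivity) (by norm_num)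
    linarith

/-- Sublinear growth of the differences of `v` over a window. -/
theorem exists_abs_sub_le (h : LogPolarSheet ε C₂ v p q) (hε : ε ≤ 1 / 2)
    (ha : a ∈ Icc (-(2 * Real.pi)) 0) :
    ∃ C, ∀ s, 1 ≤ s → ∀ t ∈ Icc a (a + 2 * Real.pi), ∀ t' ∈ Icc a (a + 2 * Real.pi),
      |v (s, t) - v (s, t')| ≤ C * Real.exp (127 / 128 * s) := by
  have hπ := Real.pi_pos
  have hab : a ≤ a + 2 * Real.pi := by linarith
  obtain ⟨C, hC⟩ := h.exists_mass_le hε ha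
  refine ⟨C + 4 * Real.pi, fun s hs t ht t' ht' => ?_⟩
  have hs0 : 0 < s := one_pos.trans_le hs
  have cp := h.smooth_p.continuousOn
  have cq := h.smooth_q.continuousOn
  refine (abs_sub_le_window h.smooth_v ha hs0 ht ht').trans ?_
  -- The AM–GM weight `e^{s/128}` balances the decay `e^{-s/64}` of the mean square: both resulting
  -- terms are of order `e^{s - s/128}`.
  set l := Real.exp (1 / 128 * s) with hl
  set m := Real.exp (-(1 / 128 * s)) with hm
  have hlm : l * m = 1 := by rw [hl, hm, ← Real.exp_add]; simp
  have hl0 : 0 < l := Real.exp_pos _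
  have hm0 : 0 < m := Real.exp_pos _
  have hiv := intervalIntegrable_window
    (contDiffOn_pd2 isOpen_logDomain h.smooth_v).continuousOn ha hs0
  have him := intervalIntegrable_window (k := fun z => p z ^ 2 + q z ^ 2)
    ((cp.pow 2).add (cq.pow 2)) ha hs0
  have key : ∫ r in a..(a + 2 * Real.pi), |pd2 v (s, r)| ≤ ∫ r in a..(a + 2 * Real.pi),
      (Real.exp s * (l * (p (s, r) ^ 2 + q (s, r) ^ 2) + 2 * m)) := by
    refine intervalIntegral.integral_mono_on hab hiv.abs
      (((him.const_mul _).add intervalIntegrable_const).const_mul _) fun r hr => ?_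
    rw [h.pd2_v s r (mem_logDomain_of_window ha hs0 hr), abs_mul, Real.abs_exp]
    refine mul_le_mul_of_nonneg_left ?_ (Real.exp_pos s).le
    have amgm (x c : ℝ) (hc : |c| ≤ 1) : |c * x| ≤ l * x ^ 2 + m := by
      rw [abs_mul]
      have h1 : |c| * |x| ≤ 1 * |x| := mul_le_mul_of_nonneg_right hc (abs_nonneg _)
      have h2 : |x| = |x| * (l * m) := by rw [hlm, mul_one]
      have h3 : l * (|x| - m) ^ 2 = l * |x| ^ 2 - 2 * (|x| * (l * m)) + m * (l * m) := by ring
      have h4 : 0 ≤ l * (|x| - m) ^ 2 := by positivity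
      rw [hlm, mul_one, mul_one, sq_abs] at h3
      have := abs_nonneg x
      linarith
    refine (abs_add_le _ _).trans ?_
    have b1 := amgm (p (s, r)) (-Real.sin r) (by rw [abs_neg]; exact Real.abs_sin_le_one r)
    have b2 := amgm (q (s, r)) (Real.cos r) (Real.abs_cos_le_one r)
    linarith
  refine key.trans ?_
  rw [intervalIntegral.integral_const_mul, intervalIntegral.integral_add (him.const_mul _)
    intervalIntegrable_const, intervalIntegral.integral_const_mul, intervalIntegral.integral_const,
    smul_eq_mul]
  have e1 : Real.exp s * m = Real.exp (127 / 128 * s) := by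
    rw [hm, ← Real.exp_add]; ring_nf
  have e2 : l * Real.exp (-(1 / 64 * s)) = m := by
    rw [hl, hm, ← Real.exp_add]; ring_nf
  have h1 := mul_le_mul_of_nonneg_left (hC s hs) hl0.le
  have h2 : l * (C * Real.exp (-(1 / 64 * s))) = C * m := by rw [← e2]; ring
  rw [h2] at h1
  calc _ ≤ Real.exp s * (C * m + (a + 2 * Real.pi - a) * (2 * m)) := by gcongr
    _ = (C + 4 * Real.pi) * (Real.exp s * m) := by ring
    _ = _ := by rw [e1]

end LogPolarSheet

/-! ### Comparison of two minimal graphs at a touching point -/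

section Algebra

/-- The minimal surface equation is invariant under rotations. -/
theorem rotate_minimal_eq {c S p q ps pt qs qt : ℝ} (hcs : S ^ 2 + c ^ 2 = 1)
    (hc : c * pt + S * qt = -S * ps + c * qs)
    (hm : (1 + q ^ 2) * (c * ps - S * pt) - p * q * (c * qs - S * qt)
      - p * q * (S * ps + c * pt) + (1 + p ^ 2) * (S * qs + c * qt) = 0) :
    (1 + (-S * p + c * q) ^ 2) * (c * ps + S * qs)
      - 2 * ((c * p + S * q) * (-S * p + c * q)) * (-S * ps + c * qs)
      + (1 + (c * p + S * q) ^ 2) * (-S * pt + c * qt) = 0 := by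
  grind

/-- The comparison of two solutions of the minimal surface equation in log-polar coordinates at a
point where their difference touches `β` from above. -/
theorem laplacian_le_of_touching {ε P Q P' Q' h₁₁ h₁₂ h₂₂ k₁₁ k₁₂ k₂₂ b₁ b₂ b₁₁ b₁₂ b₂₂ e : ℝ}
    (hε : 0 ≤ ε)
    (hPQ : P ^ 2 + Q ^ 2 ≤ ε ^ 2) (hPQ' : P' ^ 2 + Q' ^ 2 ≤ ε ^ 2)
    (h : (1 + Q ^ 2) * h₁₁ - 2 * (P * Q) * h₁₂ + (1 + P ^ 2) * h₂₂ = 0)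
    (k : (1 + Q' ^ 2) * k₁₁ - 2 * (P' * Q') * k₁₂ + (1 + P' ^ 2) * k₂₂ = 0)
    (hk₁₁ : |k₁₁| ≤ 2 * ε) (hk₁₂ : |k₁₂| ≤ 2 * ε) (hk₂₂ : |k₂₂| ≤ 2 * ε)
    (hb₁ : e * (P - P') = b₁) (hb₂ : e * (Q - Q') = b₂)
    (hpos : ∀ d₁ d₂ : ℝ, 0 ≤ (e * (h₁₁ - k₁₁) + b₁ - b₁₁) * d₁ ^ 2
      + 2 * (e * (h₁₂ - k₁₂) + b₂ - b₁₂) * (d₁ * d₂) + (e * (h₂₂ - k₂₂) - b₁ - b₂₂) * d₂ ^ 2) :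
    b₁₁ + b₂₂ ≤ 10 * ε ^ 2 * (|b₁₁| + |b₁₂| + |b₂₂| + |b₁| + |b₂|) := by
  have hP : |P| ≤ ε := abs_le_of_sq_le_sq (by nlinarith) hε
  have hQ : |Q| ≤ ε := abs_le_of_sq_le_sq (by nlinarith) hε
  have hP' : |P'| ≤ ε := abs_le_of_sq_le_sq (by nlinarith) hε
  have hQ' : |Q'| ≤ ε := abs_le_of_sq_le_sq (by nlinarith) hε
  -- Summing the form over `(1, 0)`, `(0, 1)` and `(Q, -P)` contracts it with the coefficient matrix
  -- `(1 + Q², -PQ, 1 + P²)` of the equation. The terms `b₁` and `-b₁` from the log-polar Hessian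
  -- cancel between the first two directions.
  have t1 := hpos 1 0
  have t2 := hpos 0 1
  have t3 := hpos Q (-P)
  have key : b₁₁ + b₂₂ ≤ -(Q ^ 2 * b₁₁) + 2 * (P * Q) * b₁₂ - P ^ 2 * b₂₂
      + (Q ^ 2 - P ^ 2) * b₁ - 2 * (P * Q) * b₂
      - (b₂ * (Q + Q') * k₁₁ - 2 * (P * b₂ + Q' * b₁) * k₁₂ + b₁ * (P + P') * k₂₂) := by
    -- Subtract the two equations. The differences of coefficients factor through `P - P'` and `Q -
    -- Q'`, which the touching condition expresses by `b₁` and `b₂`.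
    have e1 : b₂ * (Q + Q') * k₁₁ - 2 * (P * b₂ + Q' * b₁) * k₁₂ + b₁ * (P + P') * k₂₂
        + e * ((h₁₁ - k₁₁) + (h₂₂ - k₂₂) + Q ^ 2 * (h₁₁ - k₁₁) - 2 * (P * Q) * (h₁₂ - k₁₂)
          + P ^ 2 * (h₂₂ - k₂₂)) = 0 := by
      rw [← hb₁, ← hb₂]
      linear_combination e * h - e * k
    linarith
  have m (x y z X Y : ℝ) (hX : |x| ≤ X) (hY : |y| ≤ Y) (hX0 : 0 ≤ X) :
      |x * y * z| ≤ X * Y * |z| := by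
    rw [abs_mul, abs_mul]
    exact mul_le_mul_of_nonneg_right (mul_le_mul hX hY (abs_nonneg _) hX0) (abs_nonneg _)
  have s1 := abs_le.1 (m Q Q b₁₁ _ _ hQ hQ hε)
  have s2 := abs_le.1 (m P Q b₁₂ _ _ hP hQ hε)
  have s3 := abs_le.1 (m P P b₂₂ _ _ hP hP hε)
  have s4 := abs_le.1 (m Q Q b₁ _ _ hQ hQ hε)
  have s5 := abs_le.1 (m P P b₁ _ _ hP hP hε)
  have s6 := abs_le.1 (m P Q b₂ _ _ hP hQ hε)
  have s7 := abs_le.1 (m Q k₁₁ b₂ _ _ hQ hk₁₁ hε)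
  have s8 := abs_le.1 (m Q' k₁₁ b₂ _ _ hQ' hk₁₁ hε)
  have s9 := abs_le.1 (m P k₁₂ b₂ _ _ hP hk₁₂ hε)
  have s10 := abs_le.1 (m Q' k₁₂ b₁ _ _ hQ' hk₁₂ hε)
  have s11 := abs_le.1 (m P k₂₂ b₁ _ _ hP hk₂₂ hε)
  have s12 := abs_le.1 (m P' k₂₂ b₁ _ _ hP' hk₂₂ hε)
  have n (z : ℝ) : 0 ≤ ε ^ 2 * |z| := by positivity
  have n1 := n b₁₁
  have n2 := n b₁₂
  have n3 := n b₂₂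
  have n4 := n b₁
  have n5 := n b₂
  linarith

end Algebra

section SecondDerivative

variable {F : ℝ × ℝ → ℝ} {Ω : Set (ℝ × ℝ)} {s x : ℝ}

theorem pd_eq_zero_of_isLocalMin (hm : IsLocalMin F (s, x)) :
    pd1 F (s, x) = 0 ∧ pd2 F (s, x) = 0 := by
  have h : fderiv ℝ F (s, x) = 0 := hm.fderiv_eq_zero
  exact ⟨by simp [pd1, h], by simp [pd2, h]⟩

theorem hessian_nonneg_of_isLocalMin (hΩ : IsOpen Ω) (hF : ContDiffOn ℝ ∞ F Ω)
    (hz : (s, x) ∈ Ω) (hm : IsLocalMin F (s, x)) (d₁ d₂ : ℝ) :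
    0 ≤ pd1 (pd1 F) (s, x) * d₁ ^ 2 + 2 * pd1 (pd2 F) (s, x) * (d₁ * d₂)
      + pd2 (pd2 F) (s, x) * d₂ ^ 2 := by
  have l1 (t : ℝ) : HasDerivAt (fun t => s + t * d₁) d₁ t := by
    simpa using ((hasDerivAt_id t).mul_const d₁).const_add s
  have l2 (t : ℝ) : HasDerivAt (fun t => x + t * d₂) d₂ t := by
    simpa using ((hasDerivAt_id t).mul_const d₂).const_add x
  have hcont : Tendsto (fun t : ℝ => (s + t * d₁, x + t * d₂)) (𝓝 0) (𝓝 (s, x)) := by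
    have : Continuous fun t : ℝ => (s + t * d₁, x + t * d₂) := by fun_prop
    simpa using this.tendsto 0
  have hmem : ∀ᶠ t : ℝ in 𝓝 0, (s + t * d₁, x + t * d₂) ∈ Ω := hcont (hΩ.mem_nhds hz)
  have hmin : IsLocalMin (fun t : ℝ => F (s + t * d₁, x + t * d₂)) 0 := by
    have := hcont.eventually hm
    simpa [IsLocalMin, IsMinFilter] using this
  have hz0 : (s + 0 * d₁, x + 0 * d₂) ∈ Ω := by simpa using hz
  have hd1 := hasDerivAt_comp_pd (differentiableAt_of_contDiffOn hΩ (contDiffOn_pd1 hΩ hF) hz0)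
    (l1 0) (l2 0)
  have hd2 := hasDerivAt_comp_pd (differentiableAt_of_contDiffOn hΩ (contDiffOn_pd2 hΩ hF) hz0)
    (l1 0) (l2 0)
  have := IsLocalMin.nonneg_of_hasDerivAt hmin (hmem.mono fun t ht =>
    hasDerivAt_comp_pd (differentiableAt_of_contDiffOn hΩ hF ht) (l1 t) (l2 t))
    ((hd1.mul_const d₁).add (hd2.mul_const d₂))
  simp only [zero_mul, add_zero] at this
  rw [← pd1_pd2_comm hΩ hF hz] at this
  linarith

end SecondDerivative

/-! ### The odd part of a sheet about an angle -/

section Reflect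

variable {ε C₂ : ℝ} {v p q : ℝ × ℝ → ℝ}

/-- The domain on which the odd part of a sheet about an angle is considered. -/
def oddDomain : Set (ℝ × ℝ) := Ioi 0 ×ˢ Ioo (-(2 * Real.pi)) (2 * Real.pi)

theorem isOpen_oddDomain : IsOpen oddDomain := isOpen_Ioi.prod isOpen_Ioo

variable {t₀ s x : ℝ}

theorem add_mem_logDomain (ht₀ : t₀ ∈ Icc (-Real.pi) Real.pi) (hz : (s, x) ∈ oddDomain) :
    (s, t₀ + x) ∈ logDomain :=
  ⟨hz.1, by have := hz.2.1; simp only at this ⊢; linarith [ht₀.1],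
    by have := hz.2.2; simp only at this ⊢; linarith [ht₀.2]⟩

theorem sub_mem_logDomain (ht₀ : t₀ ∈ Icc (-Real.pi) Real.pi) (hz : (s, x) ∈ oddDomain) :
    (s, t₀ - x) ∈ logDomain :=
  ⟨hz.1, by have := hz.2.2; simp only at this ⊢; linarith [ht₀.1],
    by have := hz.2.1; simp only at this ⊢; linarith [ht₀.2]⟩

/-- The partial derivatives of `v (s, t₀ + x) + σ v (s, t₀ - x)`. -/
theorem hasDerivAt_fst_reflect {k : ℝ × ℝ → ℝ} (hk : ContDiffOn ℝ ∞ k logDomain)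
    (ht₀ : t₀ ∈ Icc (-Real.pi) Real.pi) (hz : (s, x) ∈ oddDomain) (σ : ℝ) :
    HasDerivAt (fun r => k (r, t₀ + x) + σ * k (r, t₀ - x))
      (pd1 k (s, t₀ + x) + σ * pd1 k (s, t₀ - x)) s :=
  (hasDerivAt_fst (differentiableAt_of_contDiffOn isOpen_logDomain hk
    (add_mem_logDomain ht₀ hz))).add ((hasDerivAt_fst (differentiableAt_of_contDiffOn
      isOpen_logDomain hk (sub_mem_logDomain ht₀ hz))).const_mul σ)

theorem hasDerivAt_snd_reflect {k : ℝ × ℝ → ℝ} (hk : ContDiffOn ℝ ∞ k logDomain)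
    (ht₀ : t₀ ∈ Icc (-Real.pi) Real.pi) (hz : (s, x) ∈ oddDomain) (σ : ℝ) :
    HasDerivAt (fun y => k (s, t₀ + y) + σ * k (s, t₀ - y))
      (pd2 k (s, t₀ + x) + -σ * pd2 k (s, t₀ - x)) x := by
  have h1 := hasDerivAt_snd (differentiableAt_of_contDiffOn isOpen_logDomain hk
    (add_mem_logDomain ht₀ hz))
  have h2 := hasDerivAt_snd (differentiableAt_of_contDiffOn isOpen_logDomain hk
    (sub_mem_logDomain ht₀ hz))
  refine ((h1.comp_const_add t₀ x).add ((h2.comp_const_sub t₀ x).const_mul σ)).congr_deriv ?_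
  ring

theorem contDiffOn_reflect {k : ℝ × ℝ → ℝ} (hk : ContDiffOn ℝ ∞ k logDomain)
    (ht₀ : t₀ ∈ Icc (-Real.pi) Real.pi) (σ : ℝ) :
    ContDiffOn ℝ ∞ (fun z : ℝ × ℝ => k (z.1, t₀ + z.2) + σ * k (z.1, t₀ - z.2)) oddDomain := by
  refine ContDiffOn.add ?_ (contDiffOn_const.mul ?_)
  · exact hk.comp (f := fun z : ℝ × ℝ => (z.1, t₀ + z.2))
      (ContDiff.contDiffOn (by fun_prop)) fun z hz => add_mem_logDomain ht₀ hz
  · exact hk.comp (f := fun z : ℝ × ℝ => (z.1, t₀ - z.2))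
      (ContDiff.contDiffOn (by fun_prop)) fun z hz => sub_mem_logDomain ht₀ hz

theorem pd1_reflect_sub {k b : ℝ × ℝ → ℝ} (hk : ContDiffOn ℝ ∞ k logDomain)
    (hb : ContDiff ℝ ∞ b) (ht₀ : t₀ ∈ Icc (-Real.pi) Real.pi) (hz : (s, x) ∈ oddDomain) (σ : ℝ) :
    pd1 (fun z : ℝ × ℝ => k (z.1, t₀ + z.2) + σ * k (z.1, t₀ - z.2) - b z) (s, x)
      = pd1 k (s, t₀ + x) + σ * pd1 k (s, t₀ - x) - pd1 b (s, x) :=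
  pd1_eq_of_hasDerivAt (differentiableAt_of_contDiffOn isOpen_oddDomain
    ((contDiffOn_reflect hk ht₀ σ).sub hb.contDiffOn) hz)
    ((hasDerivAt_fst_reflect hk ht₀ hz σ).sub
      (hasDerivAt_fst (hb.differentiable (by simp) (s, x))))

theorem pd2_reflect_sub {k b : ℝ × ℝ → ℝ} (hk : ContDiffOn ℝ ∞ k logDomain)
    (hb : ContDiff ℝ ∞ b) (ht₀ : t₀ ∈ Icc (-Real.pi) Real.pi) (hz : (s, x) ∈ oddDomain) (σ : ℝ) :
    pd2 (fun z : ℝ × ℝ => k (z.1, t₀ + z.2) + σ * k (z.1, t₀ - z.2) - b z) (s, x)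
      = pd2 k (s, t₀ + x) + -σ * pd2 k (s, t₀ - x) - pd2 b (s, x) :=
  pd2_eq_of_hasDerivAt (differentiableAt_of_contDiffOn isOpen_oddDomain
    ((contDiffOn_reflect hk ht₀ σ).sub hb.contDiffOn) hz)
    ((hasDerivAt_snd_reflect hk ht₀ hz σ).sub
      (hasDerivAt_snd (hb.differentiable (by simp) (s, x))))

theorem contDiff_pd1 {b : ℝ × ℝ → ℝ} (hb : ContDiff ℝ ∞ b) : ContDiff ℝ ∞ (pd1 b) :=
  contDiffOn_univ.1 (contDiffOn_pd1 isOpen_univ hb.contDiffOn)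

theorem contDiff_pd2 {b : ℝ × ℝ → ℝ} (hb : ContDiff ℝ ∞ b) : ContDiff ℝ ∞ (pd2 b) :=
  contDiffOn_univ.1 (contDiffOn_pd2 isOpen_univ hb.contDiffOn)

namespace LogPolarSheet

theorem abs_hess_le (h : LogPolarSheet ε C₂ v p q) {s t c S : ℝ} (hz : (s, t) ∈ logDomain)
    (hcs : S ^ 2 + c ^ 2 = 1) :
    |c * pd1 p (s, t) + S * pd1 q (s, t)| ≤ 2 * ε ∧
      |c * pd2 p (s, t) + S * pd2 q (s, t)| ≤ 2 * ε := by
  have hh := h.hess_le s t hz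
  have hε := h.eps_nonneg
  have b (x y : ℝ) : (c * x + S * y) ^ 2 ≤ x ^ 2 + y ^ 2 := by
    have : x ^ 2 + y ^ 2 - (c * x + S * y) ^ 2 = (S * x - c * y) ^ 2 := by
      linear_combination (-(x ^ 2 + y ^ 2)) * hcs
    nlinarith [sq_nonneg (S * x - c * y)]
  constructor
  · refine abs_le_of_sq_le_sq ((b _ _).trans ?_) (by linarith)
    nlinarith [sq_nonneg (pd2 p (s, t)), sq_nonneg (pd2 q (s, t))]
  · refine abs_le_of_sq_le_sq ((b _ _).trans ?_) (by linarith)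
    nlinarith [sq_nonneg (pd1 p (s, t)), sq_nonneg (pd1 q (s, t))]

/-- At a local minimum of the difference between the odd part of a sheet and a function `b`, the
Laplacian of `b` is small. -/
theorem laplacian_le_of_isLocalMin (h : LogPolarSheet ε C₂ v p q) {b : ℝ × ℝ → ℝ}
    (hb : ContDiff ℝ ∞ b) (ht₀ : t₀ ∈ Icc (-Real.pi) Real.pi) (hz : (s, x) ∈ oddDomain)
    (hm : IsLocalMin (fun z : ℝ × ℝ => v (z.1, t₀ + z.2) + -1 * v (z.1, t₀ - z.2) - b z) (s, x)) :
    pd1 (pd1 b) (s, x) + pd2 (pd2 b) (s, x) ≤ 10 * ε ^ 2 * (|pd1 (pd1 b) (s, x)|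
      + |pd1 (pd2 b) (s, x)| + |pd2 (pd2 b) (s, x)| + |pd1 b (s, x)| + |pd2 b (s, x)|) := by
  set F : ℝ × ℝ → ℝ := fun z => v (z.1, t₀ + z.2) + -1 * v (z.1, t₀ - z.2) - b z with hF
  have hv := h.smooth_v
  have hv1 := contDiffOn_pd1 isOpen_logDomain hv
  have hv2 := contDiffOn_pd2 isOpen_logDomain hv
  have hb1 := contDiff_pd1 hb
  have hb2 := contDiff_pd2 hb
  have hFs : ContDiffOn ℝ ∞ F oddDomain := (contDiffOn_reflect hv ht₀ _).sub hb.contDiffOn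
  have e1 : ∀ z ∈ oddDomain, pd1 F z
      = pd1 v (z.1, t₀ + z.2) + -1 * pd1 v (z.1, t₀ - z.2) - pd1 b z :=
    fun z hz => pd1_reflect_sub hv hb ht₀ hz _
  have e2 : ∀ z ∈ oddDomain, pd2 F z
      = pd2 v (z.1, t₀ + z.2) + - -1 * pd2 v (z.1, t₀ - z.2) - pd2 b z :=
    fun z hz => pd2_reflect_sub hv hb ht₀ hz _
  have n := isOpen_oddDomain.mem_nhds hz
  have e11 : pd1 (pd1 F) (s, x) = _ :=
    (pd1_congr (by filter_upwards [n] with z hz using e1 z hz)).trans (pd1_reflect_sub hv1 hb1 ht₀ hz (-1))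
  have e12 : pd1 (pd2 F) (s, x) = _ :=
    (pd1_congr (by filter_upwards [n] with z hz using e2 z hz)).trans (pd1_reflect_sub hv2 hb2 ht₀ hz (- -1))
  have e22 : pd2 (pd2 F) (s, x) = _ :=
    (pd2_congr (by filter_upwards [n] with z hz using e2 z hz)).trans (pd2_reflect_sub hv2 hb2 ht₀ hz (- -1))
  obtain ⟨z1, z2⟩ := pd_eq_zero_of_isLocalMin hm
  have hess := hessian_nonneg_of_isLocalMin isOpen_oddDomain hFs hz hm
  rw [e1 _ hz] at z1
  rw [e2 _ hz] at z2
  rw [e11, e12, e22] at hess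
  have hzp := add_mem_logDomain ht₀ hz
  have hzm := sub_mem_logDomain ht₀ hz
  rw [h.pd1_pd1_v hzp, h.pd1_pd1_v hzm, h.pd1_pd2_v hzp, h.pd1_pd2_v hzm, h.pd2_pd2_v hzp,
    h.pd2_pd2_v hzm] at hess
  simp only at z1 z2
  rw [h.pd1_v _ _ hzp, h.pd1_v _ _ hzm] at z1 hess
  rw [h.pd2_v _ _ hzp, h.pd2_v _ _ hzm] at z2 hess
  have cp := Real.sin_sq_add_cos_sq (t₀ + x)
  have cm := Real.sin_sq_add_cos_sq (t₀ - x)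
  have ap := rotate_minimal_eq cp (h.curl hzp) (h.minimal _ _ hzp)
  have am := rotate_minimal_eq cm (h.curl hzm) (h.minimal _ _ hzm)
  have gp := h.grad_le _ _ hzp
  have gm := h.grad_le _ _ hzm
  have hk1 := (h.abs_hess_le hzm cm).1
  have hk2 := (h.abs_hess_le (c := -Real.sin (t₀ - x)) (S := Real.cos (t₀ - x)) hzm
    (by linarith [neg_sq (Real.sin (t₀ - x))]))
  -- The second solution is the reflected sheet `v (s, t₀ - x)`, so its angular slope `Q'` and mixed
  -- entry `k₁₂` change sign.
  refine laplacian_le_of_touching (e := Real.exp s) h.eps_nonneg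
    (P := Real.cos (t₀ + x) * p (s, t₀ + x) + Real.sin (t₀ + x) * q (s, t₀ + x))
    (Q := -Real.sin (t₀ + x) * p (s, t₀ + x) + Real.cos (t₀ + x) * q (s, t₀ + x))
    (P' := Real.cos (t₀ - x) * p (s, t₀ - x) + Real.sin (t₀ - x) * q (s, t₀ - x))
    (Q' := -(-Real.sin (t₀ - x) * p (s, t₀ - x) + Real.cos (t₀ - x) * q (s, t₀ - x)))
    (k₁₂ := -(-Real.sin (t₀ - x) * pd1 p (s, t₀ - x) + Real.cos (t₀ - x) * pd1 q (s, t₀ - x)))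
    ?_ ?_ ap ?_ hk1 ?_ hk2.2 ?_ ?_ ?_
  · refine le_of_eq_of_le ?_ gp
    linear_combination (p (s, t₀ + x) ^ 2 + q (s, t₀ + x) ^ 2) * cp
  · refine le_of_eq_of_le ?_ gm
    linear_combination (p (s, t₀ - x) ^ 2 + q (s, t₀ - x) ^ 2) * cm
  · linarith
  · rw [abs_neg]; exact hk2.1
  · linarith
  · linarith
  · intro d₁ d₂
    refine (hess d₁ d₂).trans_eq ?_
    rw [← sub_eq_zero]
    linear_combination (d₁ ^ 2 - d₂ ^ 2) * z1 + 2 * (d₁ * d₂) * z2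
end LogPolarSheet

end Reflect

/-! ### Sums of separated exponentials -/

section Separated

variable {ι : Type*} [Fintype ι]

/-- A finite sum of products of an exponential in `s` and a function of `x`. -/
noncomputable def expSum (c l : ι → ℝ) (φ : ι → ℝ → ℝ) (z : ℝ × ℝ) : ℝ :=
  ∑ i, c i * (Real.exp (l i * z.1) * φ i z.2)

variable {c l : ι → ℝ} {φ φ' φ'' : ι → ℝ → ℝ}

theorem contDiff_expSum (hφ : ∀ i, ContDiff ℝ ∞ (φ i)) : ContDiff ℝ ∞ (expSum c l φ) := by
  refine ContDiff.sum fun i _ => contDiff_const.mul (ContDiff.mul ?_ ((hφ i).comp contDiff_snd))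
  exact Real.contDiff_exp.comp (contDiff_const.mul contDiff_fst)

theorem pd1_expSum (hφ : ∀ i, ContDiff ℝ ∞ (φ i)) :
    pd1 (expSum c l φ) = expSum (fun i => c i * l i) l φ := by
  ext ⟨s, x⟩
  refine pd1_eq_of_hasDerivAt ((contDiff_expSum hφ).differentiable (by simp) _) ?_
  simp only [expSum]
  refine HasDerivAt.fun_sum fun i _ => ?_
  refine (((((hasDerivAt_id s).const_mul (l i)).exp.mul_const (φ i x)).const_mul
    (c i))).congr_deriv ?_
  simp only [id]; ring

theorem pd2_expSum (hφ : ∀ i, ContDiff ℝ ∞ (φ i)) (hφ' : ∀ i x, HasDerivAt (φ i) (φ' i x) x) :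
    pd2 (expSum c l φ) = expSum c l φ' := by
  ext ⟨s, x⟩
  refine pd2_eq_of_hasDerivAt ((contDiff_expSum hφ).differentiable (by simp) _) ?_
  simp only [expSum]
  exact HasDerivAt.fun_sum fun i _ => ((hφ' i x).const_mul _).const_mul _

/-- The left side is subadditive in the terms and the right side additive, and each positive factor
`e^{ls}` comes out; an inequality in `x` alone for each term suffices. -/
theorem expSum_strict_subsolution (hφ : ∀ i, ContDiff ℝ ∞ (φ i)) (hφs : ∀ i, ContDiff ℝ ∞ (φ' i))
    (hφ' : ∀ i x, HasDerivAt (φ i) (φ' i x) x) (hφ'' : ∀ i x, HasDerivAt (φ' i) (φ'' i x) x)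
    [Nonempty ι] {δ s x : ℝ}
    (H : ∀ i, |c i| * (δ * (|l i ^ 2 * φ i x| + |l i * φ' i x| + |φ'' i x| + |l i * φ i x|
      + |φ' i x|)) < c i * (l i ^ 2 * φ i x + φ'' i x)) (hδ : 0 ≤ δ) :
    δ * (|pd1 (pd1 (expSum c l φ)) (s, x)| + |pd1 (pd2 (expSum c l φ)) (s, x)|
      + |pd2 (pd2 (expSum c l φ)) (s, x)| + |pd1 (expSum c l φ) (s, x)|
      + |pd2 (expSum c l φ) (s, x)|)
    < pd1 (pd1 (expSum c l φ)) (s, x) + pd2 (pd2 (expSum c l φ)) (s, x) := by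
  rw [pd1_expSum hφ, pd2_expSum hφ hφ', pd1_expSum hφ, pd1_expSum hφs, pd2_expSum hφs hφ'']
  have b (k : ι → ℝ) (f : ι → ℝ → ℝ) :
      |expSum k l f (s, x)| ≤ ∑ i, Real.exp (l i * s) * |k i * f i x| := by
    refine (Finset.abs_sum_le_sum_abs _ _).trans (Finset.sum_le_sum fun i _ => le_of_eq ?_)
    rw [mul_left_comm, abs_mul, Real.abs_exp]
  have hsum : δ * (|expSum (fun i => c i * l i * l i) l φ (s, x)|
      + |expSum (fun i => c i * l i) l φ' (s, x)| + |expSum c l φ'' (s, x)|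
      + |expSum (fun i => c i * l i) l φ (s, x)| + |expSum c l φ' (s, x)|)
      ≤ ∑ i, Real.exp (l i * s) * (|c i| * (δ * (|l i ^ 2 * φ i x| + |l i * φ' i x| + |φ'' i x|
        + |l i * φ i x| + |φ' i x|))) := by
    refine (mul_le_mul_of_nonneg_left (add_le_add (add_le_add (add_le_add (add_le_add (b _ _)
      (b _ _)) (b _ _)) (b _ _)) (b _ _)) hδ).trans (le_of_eq ?_)
    rw [← Finset.sum_add_distrib, ← Finset.sum_add_distrib, ← Finset.sum_add_distrib,
      ← Finset.sum_add_distrib, Finset.mul_sum]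
    refine Finset.sum_congr rfl fun i _ => ?_
    simp only [abs_mul, abs_pow]
    ring
  refine hsum.trans_lt ?_
  simp only [expSum]
  rw [← Finset.sum_add_distrib]
  refine Finset.sum_lt_sum_of_nonempty Finset.univ_nonempty fun i _ => ?_
  calc _ < Real.exp (l i * s) * (c i * (l i ^ 2 * φ i x + φ'' i x)) :=
        mul_lt_mul_of_pos_left (H i) (Real.exp_pos _)
    _ = _ := by ring

end Separated

/-! ### The barrier -/

/-- The growth rates of the terms of the barrier. -/
noncomputable def barrierRate (ε : ℝ) : Fin 3 → ℝ := ![-ε, -(2 / 5), 255 / 256]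

/-- The angular factors of the terms of the barrier. -/
noncomputable def barrierAngular : Fin 3 → ℝ → ℝ :=
  ![fun x => x / (2 * Real.pi) + x ^ 2 / (2 * Real.pi ^ 2), fun x => 2 * Real.pi * x - x ^ 2,
    fun x => Real.cos (511 / 512 * (x - Real.pi / 2))]

/-- The derivatives of the angular factors of the barrier. -/
noncomputable def barrierAngular' : Fin 3 → ℝ → ℝ :=
  ![fun x => 1 / (2 * Real.pi) + x / Real.pi ^ 2, fun x => 2 * Real.pi - 2 * x,
    fun x => -(511 / 512) * Real.sin (511 / 512 * (x - Real.pi / 2))]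

/-- The second derivatives of the angular factors of the barrier. -/
noncomputable def barrierAngular'' : Fin 3 → ℝ → ℝ :=
  ![fun _ => 1 / Real.pi ^ 2, fun _ => -2,
    fun x => -(511 / 512) ^ 2 * Real.cos (511 / 512 * (x - Real.pi / 2))]

/-- The barrier. -/
noncomputable def barrier (ε C₂ κ : ℝ) : ℝ × ℝ → ℝ :=
  expSum ![C₂, -10, -κ] (barrierRate ε) barrierAngular

/-- The first term carries the result: it is convex in `x`, equals `C₂ e^{-εs}` at `x = π` and has
slope `C₂ e^{-εs} / (2π)` at `0`. The second is a faster decaying correction that handles the inner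
side `s = log 2`. The third beats the growth of the odd part at infinity, since `127/128 < 255/256`,
and is removed by `κ → 0`. -/
theorem barrier_apply (ε C₂ κ s x : ℝ) : barrier ε C₂ κ (s, x)
    = C₂ * (Real.exp (-ε * s) * (x / (2 * Real.pi) + x ^ 2 / (2 * Real.pi ^ 2)))
      - 10 * (Real.exp (-(2 / 5) * s) * (2 * Real.pi * x - x ^ 2))
      - κ * (Real.exp (255 / 256 * s) * Real.cos (511 / 512 * (x - Real.pi / 2))) := by
  simp only [barrier, expSum, barrierRate, barrierAngular, Fin.sum_univ_three]
  simp only [Matrix.cons_val_zero, Matrix.cons_val_one, Matrix.cons_val]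
  ring

theorem contDiff_barrierAngular (i : Fin 3) : ContDiff ℝ ∞ (barrierAngular i) := by
  fin_cases i <;> simp [barrierAngular] <;> fun_prop

theorem contDiff_barrierAngular' (i : Fin 3) : ContDiff ℝ ∞ (barrierAngular' i) := by
  fin_cases i <;> simp [barrierAngular'] <;> fun_prop

theorem hasDerivAt_barrierAngular (i : Fin 3) (x : ℝ) :
    HasDerivAt (barrierAngular i) (barrierAngular' i x) x := by
  have hlin : HasDerivAt (fun x : ℝ => 511 / 512 * (x - Real.pi / 2)) (511 / 512 * 1) x :=
    ((hasDerivAt_id x).sub_const _).const_mul _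
  have hsq : HasDerivAt (fun x : ℝ => x ^ 2) (2 * x) x := by simpa using hasDerivAt_pow 2 x
  fin_cases i
  · refine (((hasDerivAt_id x).div_const (2 * Real.pi)).add
      (hsq.div_const (2 * Real.pi ^ 2))).congr_deriv ?_
    simp only [barrierAngular']
    change _ = 1 / (2 * Real.pi) + x / Real.pi ^ 2
    field_simp
  · refine (((hasDerivAt_id x).const_mul (2 * Real.pi)).sub hsq).congr_deriv ?_
    change _ = 2 * Real.pi - 2 * x
    ring
  · refine hlin.cos.congr_deriv ?_
    change _ = -(511 / 512) * Real.sin (511 / 512 * (x - Real.pi / 2))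
    ring

theorem hasDerivAt_barrierAngular' (i : Fin 3) (x : ℝ) :
    HasDerivAt (barrierAngular' i) (barrierAngular'' i x) x := by
  have hlin : HasDerivAt (fun x : ℝ => 511 / 512 * (x - Real.pi / 2)) (511 / 512 * 1) x :=
    ((hasDerivAt_id x).sub_const _).const_mul _
  fin_cases i
  · exact ((hasDerivAt_id x).div_const (Real.pi ^ 2)).const_add _
  · refine (((hasDerivAt_id x).const_mul (2 : ℝ)).const_sub _).congr_deriv ?_
    change _ = (-2 : ℝ)
    ring
  · refine (hlin.sin.const_mul (-(511 / 512))).congr_deriv ?_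
    change _ = -(511 / 512) ^ 2 * Real.cos (511 / 512 * (x - Real.pi / 2))
    ring

/-- The frequency `511/512 < 1` keeps the argument at distance `π/1024` from `±π/2`; then use `sin y
≥ 2y/π`. -/
theorem le_cos_barrier {x : ℝ} (hx : x ∈ Icc 0 Real.pi) :
    1 / 512 ≤ Real.cos (511 / 512 * (x - Real.pi / 2)) := by
  have hπ := Real.pi_pos
  have h1 : 2 / Real.pi * (Real.pi / 1024) ≤ Real.sin (Real.pi / 1024) :=
    Real.mul_le_sin (by positivity) (by linarith)
  have h2 : Real.cos (511 / 512 * (Real.pi / 2)) = Real.sin (Real.pi / 1024) := by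
    rw [← Real.cos_pi_div_two_sub]; ring_nf
  rw [← Real.cos_abs, ← show (2 : ℝ) / Real.pi * (Real.pi / 1024) = 1 / 512 by field_simp; norm_num]
  refine h1.trans ?_
  rw [← h2]
  apply Real.cos_le_cos_of_nonneg_of_le_pi (abs_nonneg _) (by linarith)
  rw [abs_mul, abs_of_pos (by norm_num : (0 : ℝ) < 511 / 512)]
  refine mul_le_mul_of_nonneg_left ?_ (by norm_num)
  rw [abs_le]
  constructor <;> linarith [hx.1, hx.2]

/-- Each term has a margin above the perturbation `10 ε² ≤ 10⁻⁷`: `φ'' = 1/π²` in the first, `(2/5)²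
π² < 2` in the second, and `255/256 < 511/512` with the cosine at least `1/512` in the third. -/
theorem barrier_strict_subsolution {ε C₂ κ s x : ℝ} (hε0 : 0 ≤ ε) (hε : ε < 1 / 10000)
    (hC : 0 < C₂) (hκ : 0 < κ) (hx : x ∈ Icc 0 Real.pi) :
    10 * ε ^ 2 * (|pd1 (pd1 (barrier ε C₂ κ)) (s, x)| + |pd1 (pd2 (barrier ε C₂ κ)) (s, x)|
      + |pd2 (pd2 (barrier ε C₂ κ)) (s, x)| + |pd1 (barrier ε C₂ κ) (s, x)|
      + |pd2 (barrier ε C₂ κ) (s, x)|)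
    < pd1 (pd1 (barrier ε C₂ κ)) (s, x) + pd2 (pd2 (barrier ε C₂ κ)) (s, x) := by
  have hπ3 := Real.pi_gt_three
  have hπ := Real.pi_lt_d2
  have hπ0 := Real.pi_pos
  have hδ : 10 * ε ^ 2 ≤ 1 / 10000000 := by nlinarith
  have hδ0 : 0 ≤ 10 * ε ^ 2 := by positivity
  refine expSum_strict_subsolution contDiff_barrierAngular contDiff_barrierAngular'
    hasDerivAt_barrierAngular hasDerivAt_barrierAngular' (fun i => ?_) hδ0
  fin_cases i
  · change |C₂| * (10 * ε ^ 2 * (|(-ε) ^ 2 * (x / (2 * Real.pi) + x ^ 2 / (2 * Real.pi ^ 2))|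
      + |-ε * (1 / (2 * Real.pi) + x / Real.pi ^ 2)| + |1 / Real.pi ^ 2|
      + |-ε * (x / (2 * Real.pi) + x ^ 2 / (2 * Real.pi ^ 2))|
      + |1 / (2 * Real.pi) + x / Real.pi ^ 2|))
      < C₂ * ((-ε) ^ 2 * (x / (2 * Real.pi) + x ^ 2 / (2 * Real.pi ^ 2)) + 1 / Real.pi ^ 2)
    have a1 : x / (2 * Real.pi) + x ^ 2 / (2 * Real.pi ^ 2) ≤ 1 := by
      have e1 : x / (2 * Real.pi) ≤ 1 / 2 := by rw [div_le_div_iff₀] <;> linarith [hx.2]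
      have e2 : x ^ 2 / (2 * Real.pi ^ 2) ≤ 1 / 2 := by
        rw [div_le_div_iff₀ (by positivity) (by positivity)]; nlinarith [hx.1, hx.2]
      linarith
    have a1' : 0 ≤ x / (2 * Real.pi) + x ^ 2 / (2 * Real.pi ^ 2) := by
      have := hx.1; positivity
    have a2 : 1 / (2 * Real.pi) + x / Real.pi ^ 2 ≤ 1 := by
      have e1 : 1 / (2 * Real.pi) ≤ 1 / 2 := by
        rw [div_le_div_iff₀ (by positivity) (by positivity)]; linarith
      have e2 : x / Real.pi ^ 2 ≤ 1 / 2 := by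
        rw [div_le_div_iff₀ (by positivity) (by positivity)]; nlinarith [hx.1, hx.2]
      linarith
    have a2' : 0 ≤ 1 / (2 * Real.pi) + x / Real.pi ^ 2 := by
      have := hx.1; positivity
    have a3 : 1 / Real.pi ^ 2 ≤ 1 := by
      rw [div_le_one (by positivity)]; nlinarith
    have a3' : 1 / 16 ≤ 1 / Real.pi ^ 2 := by
      rw [div_le_div_iff₀ (by positivity) (by positivity)]; nlinarith
    generalize x / (2 * Real.pi) + x ^ 2 / (2 * Real.pi ^ 2) = A at *
    generalize 1 / (2 * Real.pi) + x / Real.pi ^ 2 = B at *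
    generalize 1 / Real.pi ^ 2 = D at *
    rw [abs_of_pos hC]
    refine mul_lt_mul_of_pos_left ?_ hC
    have e1 : |(-ε) ^ 2 * A| ≤ 1 := by
      rw [abs_of_nonneg (by positivity)]; nlinarith
    have e2 : |-ε * B| ≤ 1 := by
      rw [abs_mul, abs_neg, abs_of_nonneg hε0, abs_of_nonneg a2']; nlinarith
    have e3 : |-ε * A| ≤ 1 := by
      rw [abs_mul, abs_neg, abs_of_nonneg hε0, abs_of_nonneg a1']; nlinarith
    rw [abs_of_nonneg (show 0 ≤ D by linarith), abs_of_nonneg a2']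
    have e4 : 0 ≤ (-ε) ^ 2 * A := by positivity
    have e5 : 10 * ε ^ 2 * (|(-ε) ^ 2 * A| + |-ε * B| + D + |-ε * A| + B)
        ≤ 1 / 10000000 * 5 := mul_le_mul hδ (by linarith) (by positivity) (by norm_num)
    linarith
  · change |(-10 : ℝ)| * (10 * ε ^ 2 * (|(-(2 / 5)) ^ 2 * (2 * Real.pi * x - x ^ 2)|
      + |-(2 / 5) * (2 * Real.pi - 2 * x)| + |(-2 : ℝ)|
      + |-(2 / 5) * (2 * Real.pi * x - x ^ 2)| + |2 * Real.pi - 2 * x|))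
      < -10 * ((-(2 / 5)) ^ 2 * (2 * Real.pi * x - x ^ 2) + -2)
    have a1 : 2 * Real.pi * x - x ^ 2 ≤ 10 := by nlinarith [sq_nonneg (x - Real.pi)]
    have a1' : 0 ≤ 2 * Real.pi * x - x ^ 2 := by nlinarith [hx.1, hx.2]
    have a2 : 2 * Real.pi - 2 * x ≤ 7 := by linarith [hx.1]
    have a2' : 0 ≤ 2 * Real.pi - 2 * x := by linarith [hx.2]
    generalize 2 * Real.pi * x - x ^ 2 = A at *
    generalize 2 * Real.pi - 2 * x = B at *
    rw [abs_mul, abs_mul, abs_mul, abs_of_nonneg a1', abs_of_nonneg a2']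
    norm_num
    nlinarith
  · change |-κ| * (10 * ε ^ 2 * (|(255 / 256) ^ 2 * Real.cos (511 / 512 * (x - Real.pi / 2))|
      + |255 / 256 * (-(511 / 512) * Real.sin (511 / 512 * (x - Real.pi / 2)))|
      + |-(511 / 512) ^ 2 * Real.cos (511 / 512 * (x - Real.pi / 2))|
      + |255 / 256 * Real.cos (511 / 512 * (x - Real.pi / 2))|
      + |-(511 / 512) * Real.sin (511 / 512 * (x - Real.pi / 2))|))
      < -κ * ((255 / 256) ^ 2 * Real.cos (511 / 512 * (x - Real.pi / 2))
        + -(511 / 512) ^ 2 * Real.cos (511 / 512 * (x - Real.pi / 2)))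
    have a1 := le_cos_barrier hx
    have a2 := Real.cos_le_one (511 / 512 * (x - Real.pi / 2))
    have a3 := Real.abs_sin_le_one (511 / 512 * (x - Real.pi / 2))
    generalize Real.cos (511 / 512 * (x - Real.pi / 2)) = A at *
    generalize Real.sin (511 / 512 * (x - Real.pi / 2)) = B at *
    rw [abs_neg, abs_of_pos hκ, neg_mul_comm κ]
    refine mul_lt_mul_of_pos_left ?_ hκ
    simp only [abs_mul, abs_neg]
    rw [abs_of_nonneg (show 0 ≤ A by linarith)]
    have hB := abs_nonneg B
    generalize |B| = B' at *
    norm_num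
    nlinarith

/-! ### Boundary comparison and the minimum principle -/

namespace LogPolarSheet

variable {ε C₂ : ℝ} {v p q : ℝ × ℝ → ℝ} {t₀ : ℝ}

theorem abs_pd2_v_le (h : LogPolarSheet ε C₂ v p q) {s t : ℝ} (hz : (s, t) ∈ logDomain) :
    |pd2 v (s, t)| ≤ 2 * ε * Real.exp s := by
  rw [h.pd2_v s t hz, abs_mul, Real.abs_exp, mul_comm]
  refine mul_le_mul_of_nonneg_right ((abs_add_le _ _).trans ?_) (Real.exp_pos s).le
  rw [abs_mul, abs_mul, abs_neg]
  have h1 := mul_le_mul (Real.abs_sin_le_one t) (h.abs_p_le hz) (abs_nonneg _) zero_le_one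
  have h2 := mul_le_mul (Real.abs_cos_le_one t) (h.abs_q_le hz) (abs_nonneg _) zero_le_one
  linarith

/-- Mean value inequality over an interval of length `2x`. The factor `x` is what allows the
comparison on the inner side down to the corner `x = 0`. -/
theorem abs_odd_le (h : LogPolarSheet ε C₂ v p q) (ht₀ : t₀ ∈ Icc (-Real.pi) Real.pi) {s x : ℝ}
    (hs : 0 < s) (hx : x ∈ Icc 0 Real.pi) :
    |v (s, t₀ + x) - v (s, t₀ - x)| ≤ 4 * ε * Real.exp s * x := by
  have hπ := Real.pi_pos
  have := (convex_Icc (t₀ - x) (t₀ + x)).norm_image_sub_le_of_norm_hasDerivWithin_le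
    (f := fun t => v (s, t)) (f' := fun t => pd2 v (s, t)) (C := 2 * ε * Real.exp s)
    (x := t₀ - x) (y := t₀ + x) (fun t ht => ?_) (fun t ht => ?_) ⟨le_rfl, by linarith [hx.1]⟩
    ⟨by linarith [hx.1], le_rfl⟩
  · rw [Real.norm_eq_abs, Real.norm_eq_abs,
      abs_of_nonneg (show 0 ≤ t₀ + x - (t₀ - x) by linarith [hx.1])] at this
    linarith
  all_goals
    have hz : (s, t) ∈ logDomain :=
      ⟨hs, by linarith [ht₀.1, hx.2, ht.1], by linarith [ht₀.2, hx.2, ht.2]⟩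
  · exact (hasDerivAt_snd (h.differentiableAt_v hz)).hasDerivWithinAt
  · exact h.abs_pd2_v_le hz

/-- The barrier lies below the odd part of the sheet on the lateral sides. -/
theorem barrier_le_right (h : LogPolarSheet ε C₂ v p q) (hC : 0 < C₂)
    (ht₀ : t₀ ∈ Icc (-Real.pi) Real.pi) {κ s : ℝ} (hκ : 0 < κ) (hs : 0 < s) :
    barrier ε C₂ κ (s, Real.pi) ≤ v (s, t₀ + Real.pi) - v (s, t₀ - Real.pi) := by
  have hπ := Real.pi_pos
  have hsep := h.le_sep s (t₀ - Real.pi) hs ⟨by linarith [ht₀.1], by linarith [ht₀.2]⟩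
  rw [show t₀ - Real.pi + 2 * Real.pi = t₀ + Real.pi by ring] at hsep
  refine le_trans ?_ hsep
  have e1 : Real.pi / (2 * Real.pi) + Real.pi ^ 2 / (2 * Real.pi ^ 2) = 1 := by
    field_simp; norm_num
  have e2 : 2 * Real.pi * Real.pi - Real.pi ^ 2 = Real.pi ^ 2 := by ring
  have e3 := le_cos_barrier (x := Real.pi) ⟨hπ.le, le_rfl⟩
  have e4 : Real.exp (-ε * s) ≤ Real.exp (-(ε / 4 * s)) := by
    apply Real.exp_le_exp.2
    nlinarith [mul_nonneg h.eps_nonneg hs.le]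
  have e5 : 0 ≤ Real.exp (-(2 / 5) * s) * Real.pi ^ 2 := by positivity
  have e6 : 0 ≤ κ * (Real.exp (255 / 256 * s)
      * Real.cos (511 / 512 * (Real.pi - Real.pi / 2))) :=
    mul_nonneg hκ.le (mul_nonneg (Real.exp_pos _).le (by linarith))
  have e7 := mul_le_mul_of_nonneg_left e4 hC.le
  rw [barrier_apply, e1, e2]
  linarith

/-- The barrier lies below the odd part of the sheet on the inner side. -/
theorem barrier_le_inner (h : LogPolarSheet ε C₂ v p q) (hε : ε < 1 / 10000)
    (ht₀ : t₀ ∈ Icc (-Real.pi) Real.pi) {κ x : ℝ} (hκ : 0 < κ) (hx : x ∈ Icc 0 Real.pi) :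
    barrier ε C₂ κ (Real.log 2, x) ≤ v (Real.log 2, t₀ + x) - v (Real.log 2, t₀ - x) := by
  have hπ := Real.pi_gt_three
  have hlog : 0 < Real.log 2 := Real.log_pos (by norm_num)
  have hU := (abs_le.1 (h.abs_odd_le ht₀ hlog hx)).1
  rw [Real.exp_log (by norm_num)] at hU
  have hε0 := h.eps_nonneg
  have e1 : x / (2 * Real.pi) + x ^ 2 / (2 * Real.pi ^ 2) ≤ x := by
    have a1 : x / (2 * Real.pi) ≤ x / 2 := by
      apply div_le_div_of_nonneg_left hx.1 (by norm_num) (by linarith)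
    have a2 : x ^ 2 / (2 * Real.pi ^ 2) ≤ x / 2 := by
      rw [div_le_div_iff₀ (by positivity) (by norm_num)]
      nlinarith [mul_nonneg hx.1 (sub_nonneg.2 hx.2), mul_nonneg hx.1 (sub_nonneg.2 hπ.le)]
    linarith
  have e1' : 0 ≤ x / (2 * Real.pi) + x ^ 2 / (2 * Real.pi ^ 2) := by
    have := hx.1; positivity
  have e2 : Real.exp (-ε * Real.log 2) ≤ 1 := Real.exp_le_one_iff.2 (by nlinarith)
  have e3 : 1 / 2 ≤ Real.exp (-(2 / 5) * Real.log 2) := by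
    have : Real.exp (-Real.log 2) = 1 / 2 := by
      rw [Real.exp_neg, Real.exp_log (by norm_num)]; norm_num
    rw [← this]
    exact Real.exp_le_exp.2 (by linarith)
  have e4 : 3 * x ≤ 2 * Real.pi * x - x ^ 2 := by nlinarith [hx.1, hx.2]
  have e5 := le_cos_barrier hx
  have e6 : 0 ≤ κ * (Real.exp (255 / 256 * Real.log 2)
      * Real.cos (511 / 512 * (x - Real.pi / 2))) :=
    mul_nonneg hκ.le (mul_nonneg (Real.exp_pos _).le (by linarith))
  have e7 : C₂ * (Real.exp (-ε * Real.log 2) * (x / (2 * Real.pi) + x ^ 2 / (2 * Real.pi ^ 2)))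
      ≤ 2 * ε * (1 * x) :=
    mul_le_mul h.C₂_le (mul_le_mul e2 e1 e1' zero_le_one) (by positivity) (by linarith)
  have e8 : 1 / 2 * (3 * x) ≤ Real.exp (-(2 / 5) * Real.log 2) * (2 * Real.pi * x - x ^ 2) :=
    mul_le_mul e3 e4 (by linarith [hx.1]) (Real.exp_pos _).le
  have e9 : ε * x ≤ 1 / 10000 * x := mul_le_mul_of_nonneg_right hε.le hx.1
  -- The barrier is at most `2εx - 15x`, while the odd part is at least `-8εx`.
  rw [barrier_apply]
  linarith [hx.1]

/-- The barrier lies below the odd part of the sheet far away. -/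
theorem exists_barrier_le_outer (h : LogPolarSheet ε C₂ v p q) (hε : ε < 1 / 10000)
    (hC : 0 < C₂) (ht₀ : t₀ ∈ Icc (-Real.pi) Real.pi) {κ : ℝ} (hκ : 0 < κ) :
    ∃ S₀, ∀ s, S₀ ≤ s → ∀ x ∈ Icc 0 Real.pi,
      barrier ε C₂ κ (s, x) ≤ v (s, t₀ + x) - v (s, t₀ - x) := by
  have hπ := Real.pi_pos
  have ha : t₀ - Real.pi ∈ Icc (-(2 * Real.pi)) 0 := ⟨by linarith [ht₀.1], by linarith [ht₀.2]⟩
  obtain ⟨C, hCv⟩ := h.exists_abs_sub_le (by linarith) ha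
  -- The exponent is `1/256 = 255/256 - 127/128`, and `κ/512` is the least coefficient of the cosine
  -- term.
  obtain ⟨S, hS⟩ := exists_forall_exp_neg_lt (a := 1 / 256) (δ := κ / 512) (by norm_num)
    (by positivity) (C + C₂)
  refine ⟨max S 1, fun s hs x hx => ?_⟩
  have hs1 : 1 ≤ s := (le_max_right _ _).trans hs
  have hU := (abs_le.1 (hCv s hs1 (t₀ + x) ⟨by linarith [hx.1], by linarith [hx.2]⟩ (t₀ - x)
    ⟨by linarith [hx.2], by linarith [hx.1]⟩)).1
  have hSs := hS s ((le_max_left _ _).trans hs)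
  have hε0 := h.eps_nonneg
  have a1 : x / (2 * Real.pi) + x ^ 2 / (2 * Real.pi ^ 2) ≤ 1 := by
    have e1 : x / (2 * Real.pi) ≤ 1 / 2 := by rw [div_le_div_iff₀] <;> linarith [hx.2]
    have e2 : x ^ 2 / (2 * Real.pi ^ 2) ≤ 1 / 2 := by
      rw [div_le_div_iff₀ (by positivity) (by positivity)]; nlinarith [hx.1, hx.2]
    linarith
  have a1' : 0 ≤ x / (2 * Real.pi) + x ^ 2 / (2 * Real.pi ^ 2) := by
    have := hx.1; positivity
  have e2 : Real.exp (-ε * s) ≤ 1 := Real.exp_le_one_iff.2 (by nlinarith)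
  have e3 : C₂ * (Real.exp (-ε * s) * (x / (2 * Real.pi) + x ^ 2 / (2 * Real.pi ^ 2)))
      ≤ C₂ * (1 * 1) :=
    mul_le_mul_of_nonneg_left (mul_le_mul e2 a1 a1' zero_le_one) hC.le
  have e4 : 0 ≤ Real.exp (-(2 / 5) * s) * (2 * Real.pi * x - x ^ 2) :=
    mul_nonneg (Real.exp_pos _).le (by nlinarith [hx.1, hx.2])
  have e5 : κ * (Real.exp (255 / 256 * s) * (1 / 512))
      ≤ κ * (Real.exp (255 / 256 * s) * Real.cos (511 / 512 * (x - Real.pi / 2))) :=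
    mul_le_mul_of_nonneg_left (mul_le_mul_of_nonneg_left (le_cos_barrier hx)
      (Real.exp_pos _).le) hκ.le
  have e6 : Real.exp (255 / 256 * s) * Real.exp (-(1 / 256 * s)) = Real.exp (127 / 128 * s) := by
    rw [← Real.exp_add]; ring_nf
  have e7 := mul_le_mul_of_nonneg_left hSs.le (Real.exp_pos (255 / 256 * s)).le
  have e8 : Real.exp (255 / 256 * s) * ((C + C₂) * Real.exp (-(1 / 256 * s)))
      = (C + C₂) * Real.exp (127 / 128 * s) := by rw [← e6]; ring
  have e9 : C₂ * 1 ≤ C₂ * Real.exp (127 / 128 * s) :=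
    mul_le_mul_of_nonneg_left (Real.one_le_exp (by linarith)) hC.le
  rw [barrier_apply]
  linarith

/-- Cut the strip off far out. A negative minimum of odd part minus barrier is excluded on three
sides by the boundary lemmas and on `x = 0` because only the `κ` term survives there; in the
interior it contradicts strict subharmonicity. -/
theorem barrier_le (h : LogPolarSheet ε C₂ v p q) (hε : ε < 1 / 10000) (hC : 0 < C₂)
    (ht₀ : t₀ ∈ Icc (-Real.pi) Real.pi) {κ s x : ℝ} (hκ : 0 < κ) (hs : Real.log 2 ≤ s)
    (hx : x ∈ Icc 0 Real.pi) : barrier ε C₂ κ (s, x) ≤ v (s, t₀ + x) - v (s, t₀ - x) := by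
  by_contra! hneg
  have hπ := Real.pi_pos
  have hlog : 0 < Real.log 2 := Real.log_pos (by norm_num)
  obtain ⟨S₀, hS₀⟩ := h.exists_barrier_le_outer hε hC ht₀ hκ
  set S := max S₀ s with hS
  set F : ℝ × ℝ → ℝ := fun z => v (z.1, t₀ + z.2) + -1 * v (z.1, t₀ - z.2) - barrier ε C₂ κ z
    with hF
  have hb : ContDiff ℝ ∞ (barrier ε C₂ κ) := contDiff_expSum contDiff_barrierAngular
  have hFs : ContDiffOn ℝ ∞ F oddDomain := (contDiffOn_reflect h.smooth_v ht₀ _).sub hb.contDiffOn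
  have hsub : Icc (Real.log 2) S ×ˢ Icc 0 Real.pi ⊆ oddDomain := fun z hz =>
    ⟨hlog.trans_le hz.1.1, by have := hz.2.1; linarith,
      by have := hz.2.2; linarith⟩
  obtain ⟨z, hzK, hzmin⟩ := (isCompact_Icc.prod isCompact_Icc).exists_isMinOn
    ⟨(s, x), ⟨hs, le_max_right _ _⟩, hx⟩ (hFs.continuousOn.mono hsub)
  have hFz : F z < 0 := by
    refine (hzmin (show (s, x) ∈ Icc (Real.log 2) S ×ˢ Icc 0 Real.pi from
      ⟨⟨hs, le_max_right _ _⟩, hx⟩)).trans_lt ?_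
    simp only [hF]; linarith
  obtain ⟨s', x'⟩ := z
  simp only [hF] at hFz
  have hs' : s' ∈ Icc (Real.log 2) S := hzK.1
  have hx' : x' ∈ Icc 0 Real.pi := hzK.2
  have hs'0 : 0 < s' := hlog.trans_le hs'.1
  have n1 : s' ≠ Real.log 2 := by
    rintro rfl
    have := h.barrier_le_inner hε ht₀ hκ hx'
    linarith
  have n2 : s' ≠ S := by
    rintro rfl
    have := hS₀ S (le_max_left _ _) x' hx'
    linarith
  have n3 : x' ≠ Real.pi := by
    rintro rfl
    have := h.barrier_le_right hC ht₀ hκ hs'0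
    linarith
  have n4 : x' ≠ 0 := by
    rintro rfl
    rw [barrier_apply] at hFz
    have := le_cos_barrier hx'
    have : 0 < κ * (Real.exp (255 / 256 * s') * Real.cos (511 / 512 * (0 - Real.pi / 2))) :=
      mul_pos hκ (mul_pos (Real.exp_pos _) (by linarith))
    norm_num at hFz
    norm_num at this
    linarith
  have hnhds : Icc (Real.log 2) S ×ˢ Icc 0 Real.pi ∈ 𝓝 (s', x') :=
    prod_mem_nhds (Icc_mem_nhds (lt_of_le_of_ne hs'.1 n1.symm) (lt_of_le_of_ne hs'.2 n2))
      (Icc_mem_nhds (lt_of_le_of_ne hx'.1 n4.symm) (lt_of_le_of_ne hx'.2 n3))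
  have hloc : IsLocalMin F (s', x') := hzmin.isLocalMin hnhds
  have h1 := h.laplacian_le_of_isLocalMin hb ht₀ (hsub hzK) hloc
  have h2 := barrier_strict_subsolution (s := s') h.eps_nonneg hε hC hκ hx'
  exact absurd h1 (not_le.2 h2)

/-- The lower bound for the odd part of a sheet. -/
theorem le_odd (h : LogPolarSheet ε C₂ v p q) (hε : ε < 1 / 10000) (hC : 0 < C₂)
    (ht₀ : t₀ ∈ Icc (-Real.pi) Real.pi) {s x : ℝ} (hs : Real.log 2 ≤ s)
    (hx : x ∈ Icc 0 Real.pi) : barrier ε C₂ 0 (s, x) ≤ v (s, t₀ + x) - v (s, t₀ - x) := by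
  have hlim : Tendsto (fun κ => barrier ε C₂ κ (s, x)) (𝓝[>] 0) (𝓝 (barrier ε C₂ 0 (s, x))) := by
    have : Continuous fun κ => barrier ε C₂ κ (s, x) := by
      simp only [barrier_apply]; fun_prop
    exact this.continuousWithinAt
  exact le_of_tendsto hlim (eventually_nhdsWithin_of_forall fun κ hκ =>
    h.barrier_le hε hC ht₀ hκ hs hx)

theorem _root_.HasDerivAt.nonneg_of_forall_le {f : ℝ → ℝ} {c b : ℝ} (hb : 0 < b)
    (hf : HasDerivAt f c 0) (h0 : f 0 = 0) (h : ∀ x ∈ Icc 0 b, 0 ≤ f x) : 0 ≤ c := by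
  have hs : Tendsto (slope f 0) (𝓝[>] 0) (𝓝 c) :=
    hf.tendsto_slope.mono_left (nhdsWithin_mono _ fun x hx => ne_of_gt hx)
  refine ge_of_tendsto hs ?_
  filter_upwards [Ioc_mem_nhdsGT hb] with x hx
  rw [slope_def_field, h0, sub_zero, sub_zero]
  exact div_nonneg (h x ⟨hx.1.le, hx.2⟩) hx.1.le

/-- The lower bound for the angular derivative of a sheet. -/
theorem le_pd2_v (h : LogPolarSheet ε C₂ v p q) (hε : ε < 1 / 10000) (hC : 0 < C₂)
    (ht₀ : t₀ ∈ Icc (-Real.pi) Real.pi) {s : ℝ} (hs : Real.log 2 ≤ s) :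
    C₂ / (4 * Real.pi) * Real.exp (-ε * s) - 10 * Real.pi * Real.exp (-(2 / 5) * s)
      ≤ pd2 v (s, t₀) := by
  have hπ := Real.pi_pos
  have hs0 : 0 < s := (Real.log_pos (by norm_num)).trans_le hs
  have hz : (s, (0 : ℝ)) ∈ oddDomain := ⟨hs0, by simp; linarith, by simp; linarith⟩
  have hd1 := hasDerivAt_snd_reflect h.smooth_v ht₀ hz (-1)
  have hb : ContDiff ℝ ∞ (barrier ε C₂ 0) := contDiff_expSum contDiff_barrierAngular
  have hd2 := hasDerivAt_snd (hb.differentiable (by simp) (s, (0 : ℝ)))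
  have hpd : pd2 (barrier ε C₂ 0) (s, 0)
      = C₂ * (Real.exp (-ε * s) * (1 / (2 * Real.pi)))
        - 10 * (Real.exp (-(2 / 5) * s) * (2 * Real.pi)) := by
    rw [barrier, pd2_expSum contDiff_barrierAngular hasDerivAt_barrierAngular]
    simp only [expSum, barrierRate, barrierAngular', Fin.sum_univ_three]
    simp only [Matrix.cons_val_zero, Matrix.cons_val_one, Matrix.cons_val]
    ring
  -- With `κ = 0` both functions vanish at `x = 0`, so their order passes to the slopes; the slope
  -- of the odd part is twice the angular derivative.
  have := (hd1.sub hd2).nonneg_of_forall_le hπ (by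
      simp only [Pi.sub_apply, barrier_apply]; simp) fun x hx => by
    have := h.le_odd hε hC ht₀ hs hx
    simp only [Pi.sub_apply]
    linarith
  rw [hpd] at this
  simp only [add_zero, sub_zero, neg_neg, one_mul] at this
  have e : C₂ / (4 * Real.pi) * Real.exp (-ε * s)
      = 1 / 2 * (C₂ * (Real.exp (-ε * s) * (1 / (2 * Real.pi)))) := by field_simp; ring
  rw [e]
  linarith

end LogPolarSheet

/-- Strict spiraling in logarithmic polar coordinates. -/
theorem exists_forall_le_pd2 {C₂ : ℝ} (hC : 0 < C₂) : ∃ S₀ : ℝ, Real.log 2 ≤ S₀ ∧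
    ∀ (ε : ℝ) (v p q : ℝ × ℝ → ℝ), ε < 1 / 10000 → LogPolarSheet ε C₂ v p q →
      ∀ s t, S₀ ≤ s → t ∈ Icc (-Real.pi) Real.pi →
        C₂ / (8 * Real.pi) * Real.exp (-ε * s) ≤ pd2 v (s, t) := by
  have hπ := Real.pi_pos
  obtain ⟨S, hS⟩ := exists_forall_exp_neg_lt (a := 3 / 10) (δ := C₂ / (8 * Real.pi))
    (by norm_num) (by positivity) (10 * Real.pi)
  refine ⟨max S (Real.log 2), le_max_right _ _, fun ε v p q hε h s t hs ht => ?_⟩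
  have hs2 : Real.log 2 ≤ s := (le_max_right _ _).trans hs
  have hs0 : 0 < s := (Real.log_pos (by norm_num)).trans_le hs2
  refine le_trans ?_ (h.le_pd2_v hε hC ht hs2)
  have h1 := hS s ((le_max_left _ _).trans hs)
  -- Uses `ε + 3/10 ≤ 2/5`. For large `s` the correction then takes at most half of the main term,
  -- which turns `4π` into `8π`.
  have h2 : Real.exp (-(2 / 5) * s) ≤ Real.exp (-ε * s) * Real.exp (-(3 / 10 * s)) := by
    rw [← Real.exp_add]
    apply Real.exp_le_exp.2
    nlinarith
  have h3 := mul_le_mul_of_nonneg_left h1.le (Real.exp_pos (-ε * s)).le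
  have h4 := mul_le_mul_of_nonneg_left h2 (show 0 ≤ 10 * Real.pi by positivity)
  have e : C₂ / (4 * Real.pi) = 2 * (C₂ / (8 * Real.pi)) := by field_simp; norm_num
  rw [e]
  linarith

/-! ### From polar to log-polar coordinates -/

/-- A function on a polar domain in the coordinates `(log ρ, θ)`. -/
noncomputable def lift (g : ℝ → ℝ → ℝ) (z : ℝ × ℝ) : ℝ := g (Real.exp z.1) z.2

section Lift

variable {g : ℝ → ℝ → ℝ} {s t : ℝ}

theorem dRho_exp (hg : DifferentiableAt ℝ (lift g) (s, t)) :
    dRho g (Real.exp s) t = Real.exp (-s) * pd1 (lift g) (s, t) := by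
  have hlog : HasDerivAt Real.log (Real.exp s)⁻¹ (Real.exp s) :=
    Real.hasDerivAt_log (Real.exp_pos s).ne'
  have h1 : HasDerivAt (fun r => lift g (r, t)) (pd1 (lift g) (s, t)) (Real.log (Real.exp s)) := by
    rw [Real.log_exp]; exact hasDerivAt_fst hg
  have h2 := h1.comp (Real.exp s) hlog
  have h3 : (fun r => g r t) =ᶠ[𝓝 (Real.exp s)] (fun r => lift g (r, t)) ∘ Real.log := by
    filter_upwards [Ioi_mem_nhds (Real.exp_pos s)] with r hr
    simp only [Function.comp, lift, Real.exp_log hr]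
  rw [dRho, h3.deriv_eq, h2.deriv, Real.exp_neg, mul_comm]

theorem dTheta_exp (hg : DifferentiableAt ℝ (lift g) (s, t)) :
    dTheta g (Real.exp s) t = pd2 (lift g) (s, t) :=
  (hasDerivAt_snd hg).deriv

theorem dX_exp (hg : DifferentiableAt ℝ (lift g) (s, t)) :
    dX g (Real.exp s) t
      = Real.exp (-s) * (Real.cos t * pd1 (lift g) (s, t) - Real.sin t * pd2 (lift g) (s, t)) := by
  rw [dX, dRho_exp hg, dTheta_exp hg, Real.exp_neg]; ring

theorem dY_exp (hg : DifferentiableAt ℝ (lift g) (s, t)) :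
    dY g (Real.exp s) t
      = Real.exp (-s) * (Real.sin t * pd1 (lift g) (s, t) + Real.cos t * pd2 (lift g) (s, t)) := by
  rw [dY, dRho_exp hg, dTheta_exp hg, Real.exp_neg]; ring

theorem sq_gradNorm (u : ℝ → ℝ → ℝ) (ρ θ : ℝ) :
    gradNorm u ρ θ ^ 2 = dX u ρ θ ^ 2 + dY u ρ θ ^ 2 :=
  Real.sq_sqrt (by positivity)

theorem gradNorm_nonneg (u : ℝ → ℝ → ℝ) (ρ θ : ℝ) : 0 ≤ gradNorm u ρ θ := Real.sqrt_nonneg _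

theorem hessNorm_nonneg (u : ℝ → ℝ → ℝ) (ρ θ : ℝ) : 0 ≤ hessNorm u ρ θ := Real.sqrt_nonneg _

/-- The coordinate change is conformal with factor `e^s`; the remaining rotation preserves sums of
squares. -/
theorem sq_hessNorm_exp {u : ℝ → ℝ → ℝ} (hp : DifferentiableAt ℝ (lift (dX u)) (s, t))
    (hq : DifferentiableAt ℝ (lift (dY u)) (s, t)) :
    (Real.exp s * hessNorm u (Real.exp s) t) ^ 2 =
      pd1 (lift (dX u)) (s, t) ^ 2 + pd2 (lift (dX u)) (s, t) ^ 2
        + pd1 (lift (dY u)) (s, t) ^ 2 + pd2 (lift (dY u)) (s, t) ^ 2 := by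
  have hcs := Real.sin_sq_add_cos_sq t
  have he : Real.exp s * Real.exp (-s) = 1 := by rw [← Real.exp_add]; simp
  rw [mul_pow, hessNorm, Real.sq_sqrt (by positivity), dX_exp hp, dX_exp hq, dY_exp hp, dY_exp hq]
  generalize pd1 (lift (dX u)) (s, t) = a
  generalize pd2 (lift (dX u)) (s, t) = b
  generalize pd1 (lift (dY u)) (s, t) = c
  generalize pd2 (lift (dY u)) (s, t) = d
  have e : Real.exp s ^ 2 * ((Real.exp (-s) * (Real.cos t * a - Real.sin t * b)) ^ 2
      + (Real.exp (-s) * (Real.cos t * c - Real.sin t * d)) ^ 2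
      + (Real.exp (-s) * (Real.sin t * a + Real.cos t * b)) ^ 2
      + (Real.exp (-s) * (Real.sin t * c + Real.cos t * d)) ^ 2)
      = (Real.exp s * Real.exp (-s)) ^ 2 * ((Real.sin t ^ 2 + Real.cos t ^ 2)
        * (a ^ 2 + b ^ 2 + c ^ 2 + d ^ 2)) := by ring
  rw [e, he, hcs]; ring

end Lift

theorem hasDerivAt_div_sqrt {P Q : ℝ → ℝ} {P' Q' r : ℝ} (hP : HasDerivAt P P' r)
    (hQ : HasDerivAt Q Q' r) :
    HasDerivAt (fun r => P r / √(1 + (P r ^ 2 + Q r ^ 2)))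
      ((P' * (1 + Q r ^ 2) - P r * Q r * Q') / √(1 + (P r ^ 2 + Q r ^ 2)) ^ 3) r := by
  have h0 : 0 < 1 + (P r ^ 2 + Q r ^ 2) := by positivity
  have hW : HasDerivAt (fun r => 1 + (P r ^ 2 + Q r ^ 2)) (2 * (P r * P' + Q r * Q')) r := by
    refine (((hP.pow 2).add (hQ.pow 2)).const_add 1).congr_deriv ?_
    push_cast; ring
  have hs := Real.sqrt_pos.2 h0
  have hsq := Real.sq_sqrt h0.le
  refine (hP.div (hW.sqrt h0.ne') hs.ne').congr_deriv ?_
  generalize √(1 + (P r ^ 2 + Q r ^ 2)) = W at *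
  field_simp
  rw [hsq]; ring

section Conversion

variable {ε C₂ : ℝ} {u : ℝ → ℝ → ℝ}

/-- The domain of the separation of a `3`-valued graph in the coordinates `(log ρ, θ)`. -/
def sepDomain : Set (ℝ × ℝ) := Ioi 0 ×ˢ Ioo (-(3 * Real.pi)) Real.pi

theorem isOpen_sepDomain : IsOpen sepDomain := isOpen_Ioi.prod isOpen_Ioo

theorem mem_logDomain_of_sepDomain {s t : ℝ} (hz : (s, t) ∈ sepDomain) : (s, t) ∈ logDomain :=
  ⟨hz.1, hz.2.1, hz.2.2.trans (by linarith [Real.pi_pos])⟩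

theorem shift_mem_logDomain {s t : ℝ} (hz : (s, t) ∈ sepDomain) :
    (s, t + 2 * Real.pi) ∈ logDomain := by
  have h1 : -(3 * Real.pi) < t := hz.2.1
  have h2 : t < Real.pi := hz.2.2
  exact ⟨hz.1, by simp only; linarith [Real.pi_pos], by simp only; linarith⟩

theorem exp_mem_openPolarRect {s t : ℝ} (hz : (s, t) ∈ logDomain) :
    (Real.exp s, t) ∈ openPolarRect 1 (-(Real.pi * (3 : ℕ))) (Real.pi * (3 : ℕ)) := by
  have h1 : -(3 * Real.pi) < t := hz.2.1
  have h2 : t < 3 * Real.pi := hz.2.2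
  refine ⟨Real.one_lt_exp_iff.2 hz.1, ?_, ?_⟩ <;> push_cast <;> linarith

theorem exp_mem_sepRect {s t : ℝ} (hz : (s, t) ∈ sepDomain) :
    (Real.exp s, t) ∈ openPolarRect 1 (-(Real.pi * (3 : ℕ)))
      (Real.pi * (3 : ℕ) - 2 * Real.pi) := by
  have h1 : -(3 * Real.pi) < t := hz.2.1
  have h2 : t < Real.pi := hz.2.2
  refine ⟨Real.one_lt_exp_iff.2 hz.1, ?_, ?_⟩ <;> push_cast <;> linarith

namespace IsSheet

theorem contDiffOn_lift (h : IsSheet 3 ε 1 u) : ContDiffOn ℝ ∞ (lift u) logDomain :=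
  h.smoothOn.comp (f := fun z : ℝ × ℝ => (Real.exp z.1, z.2))
    (ContDiff.contDiffOn (by fun_prop)) fun z hz => exp_mem_openPolarRect hz

theorem differentiableAt_lift (h : IsSheet 3 ε 1 u) {z : ℝ × ℝ} (hz : z ∈ logDomain) :
    DifferentiableAt ℝ (lift u) z :=
  differentiableAt_of_contDiffOn isOpen_logDomain h.contDiffOn_lift hz

theorem contDiffOn_lift_dX (h : IsSheet 3 ε 1 u) : ContDiffOn ℝ ∞ (lift (dX u)) logDomain := by
  have h1 := contDiffOn_pd1 isOpen_logDomain h.contDiffOn_lift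
  have h2 := contDiffOn_pd2 isOpen_logDomain h.contDiffOn_lift
  have hc : ContDiff ℝ ∞ fun z : ℝ × ℝ => Real.cos z.2 := by fun_prop
  have hs : ContDiff ℝ ∞ fun z : ℝ × ℝ => Real.sin z.2 := by fun_prop
  have he : ContDiff ℝ ∞ fun z : ℝ × ℝ => Real.exp (-z.1) := by fun_prop
  exact (he.contDiffOn.mul ((hc.contDiffOn.mul h1).sub (hs.contDiffOn.mul h2))).congr
    fun z hz => dX_exp (h.differentiableAt_lift hz)

theorem contDiffOn_lift_dY (h : IsSheet 3 ε 1 u) : ContDiffOn ℝ ∞ (lift (dY u)) logDomain := by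
  have h1 := contDiffOn_pd1 isOpen_logDomain h.contDiffOn_lift
  have h2 := contDiffOn_pd2 isOpen_logDomain h.contDiffOn_lift
  have hc : ContDiff ℝ ∞ fun z : ℝ × ℝ => Real.cos z.2 := by fun_prop
  have hs : ContDiff ℝ ∞ fun z : ℝ × ℝ => Real.sin z.2 := by fun_prop
  have he : ContDiff ℝ ∞ fun z : ℝ × ℝ => Real.exp (-z.1) := by fun_prop
  exact (he.contDiffOn.mul ((hs.contDiffOn.mul h1).add (hc.contDiffOn.mul h2))).congr
    fun z hz => dY_exp (h.differentiableAt_lift hz)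

theorem differentiableAt_lift_dX (h : IsSheet 3 ε 1 u) {z : ℝ × ℝ} (hz : z ∈ logDomain) :
    DifferentiableAt ℝ (lift (dX u)) z :=
  differentiableAt_of_contDiffOn isOpen_logDomain h.contDiffOn_lift_dX hz

theorem differentiableAt_lift_dY (h : IsSheet 3 ε 1 u) {z : ℝ × ℝ} (hz : z ∈ logDomain) :
    DifferentiableAt ℝ (lift (dY u)) z :=
  differentiableAt_of_contDiffOn isOpen_logDomain h.contDiffOn_lift_dY hz

variable {s t : ℝ}

theorem pd1_lift (h : IsSheet 3 ε 1 u) (hz : (s, t) ∈ logDomain) :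
    pd1 (lift u) (s, t) = Real.exp s
      * (Real.cos t * lift (dX u) (s, t) + Real.sin t * lift (dY u) (s, t)) := by
  have hcs := Real.sin_sq_add_cos_sq t
  have he : Real.exp s * Real.exp (-s) = 1 := by rw [← Real.exp_add]; simp
  simp only [lift] at *
  rw [dX_exp (h.differentiableAt_lift hz), dY_exp (h.differentiableAt_lift hz)]
  linear_combination (-(pd1 (lift u) (s, t))) * he
    - (Real.exp s * Real.exp (-s) * pd1 (lift u) (s, t)) * hcs

theorem pd2_lift (h : IsSheet 3 ε 1 u) (hz : (s, t) ∈ logDomain) :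
    pd2 (lift u) (s, t) = Real.exp s
      * (-Real.sin t * lift (dX u) (s, t) + Real.cos t * lift (dY u) (s, t)) := by
  have hcs := Real.sin_sq_add_cos_sq t
  have he : Real.exp s * Real.exp (-s) = 1 := by rw [← Real.exp_add]; simp
  simp only [lift] at *
  rw [dX_exp (h.differentiableAt_lift hz), dY_exp (h.differentiableAt_lift hz)]
  linear_combination (-(pd2 (lift u) (s, t))) * he
    - (Real.exp s * Real.exp (-s) * pd2 (lift u) (s, t)) * hcs

theorem nonneg_eps (h : IsSheet 3 ε 1 u) : 0 ≤ ε := by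
  refine (Real.sqrt_nonneg _).trans (h.gradNorm_le (Real.exp 1) 0 (exp_mem_openPolarRect ?_))
  have := Real.pi_pos
  exact ⟨by simp, by simp only; linarith, by simp only; linarith⟩

theorem sq_grad_le (h : IsSheet 3 ε 1 u) (hz : (s, t) ∈ logDomain) :
    lift (dX u) (s, t) ^ 2 + lift (dY u) (s, t) ^ 2 ≤ ε ^ 2 := by
  simp only [lift]
  rw [← sq_gradNorm]
  exact pow_le_pow_left₀ (Real.sqrt_nonneg _)
    (h.gradNorm_le _ _ (exp_mem_openPolarRect hz)) 2

theorem minimal_lift (h : IsSheet 3 ε 1 u) (hz : (s, t) ∈ logDomain) :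
    (1 + lift (dY u) (s, t) ^ 2)
        * (Real.cos t * pd1 (lift (dX u)) (s, t) - Real.sin t * pd2 (lift (dX u)) (s, t))
      - lift (dX u) (s, t) * lift (dY u) (s, t)
        * (Real.cos t * pd1 (lift (dY u)) (s, t) - Real.sin t * pd2 (lift (dY u)) (s, t))
      - lift (dX u) (s, t) * lift (dY u) (s, t)
        * (Real.sin t * pd1 (lift (dX u)) (s, t) + Real.cos t * pd2 (lift (dX u)) (s, t))
      + (1 + lift (dX u) (s, t) ^ 2)
        * (Real.sin t * pd1 (lift (dY u)) (s, t) + Real.cos t * pd2 (lift (dY u)) (s, t)) = 0 := by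
  have hm := h.minimal _ _ (exp_mem_openPolarRect hz)
  have hp := h.differentiableAt_lift_dX hz
  have hq := h.differentiableAt_lift_dY hz
  set p := lift (dX u) with hpdef
  set q := lift (dY u) with hqdef
  have hl1 : lift (fun r t => dX u r t / √(1 + gradNorm u r t ^ 2))
      = fun z => p z / √(1 + (p z ^ 2 + q z ^ 2)) := by
    ext z; simp only [lift, sq_gradNorm, hpdef, hqdef]
  have hl2 : lift (fun r t => dY u r t / √(1 + gradNorm u r t ^ 2))
      = fun z => q z / √(1 + (q z ^ 2 + p z ^ 2)) := by
    ext z; simp only [lift, sq_gradNorm, hpdef, hqdef, add_comm (dX u _ _ ^ 2)]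
  have hd {f k : ℝ × ℝ → ℝ} (hf : DifferentiableAt ℝ f (s, t))
      (hk : DifferentiableAt ℝ k (s, t)) :
      DifferentiableAt ℝ (fun z => f z / √(1 + (f z ^ 2 + k z ^ 2))) (s, t) := by
    have h0 : 0 < 1 + (f (s, t) ^ 2 + k (s, t) ^ 2) := by positivity
    have hsq : DifferentiableAt ℝ (fun z => √(1 + (f z ^ 2 + k z ^ 2))) (s, t) :=
      DifferentiableAt.sqrt (f := fun z => 1 + (f z ^ 2 + k z ^ 2))
        (((hf.pow 2).add (hk.pow 2)).const_add 1) h0.ne'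
    have := hf.mul (hsq.inv (Real.sqrt_pos.2 h0).ne')
    simp only [div_eq_mul_inv]
    exact this
  have d1 := hd hp hq
  have d2 := hd hq hp
  rw [MinimalSurfaceEqAt, dX_exp (by rw [hl1]; exact d1), dY_exp (by rw [hl2]; exact d2), hl1, hl2,
    pd1_eq_of_hasDerivAt d1 (hasDerivAt_div_sqrt (hasDerivAt_fst hp) (hasDerivAt_fst hq)),
    pd2_eq_of_hasDerivAt d1 (hasDerivAt_div_sqrt (hasDerivAt_snd hp) (hasDerivAt_snd hq)),
    pd1_eq_of_hasDerivAt d2 (hasDerivAt_div_sqrt (hasDerivAt_fst hq) (hasDerivAt_fst hp)),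
    pd2_eq_of_hasDerivAt d2 (hasDerivAt_div_sqrt (hasDerivAt_snd hq) (hasDerivAt_snd hp)),
    add_comm (q (s, t) ^ 2) (p (s, t) ^ 2)] at hm
  have hW : 0 < √(1 + (p (s, t) ^ 2 + q (s, t) ^ 2)) := Real.sqrt_pos.2 (by positivity)
  have he := Real.exp_pos (-s)
  generalize √(1 + (p (s, t) ^ 2 + q (s, t) ^ 2)) = W at *
  generalize Real.exp (-s) = e at *
  -- Clearing `W` turns the divergence form into the non-divergence form, up to the factor `e`.
  field_simp at hm
  linear_combination (mul_eq_zero.1 (hm.trans (mul_zero _))).resolve_left he.ne'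

theorem abs_u_le (h : IsSheet 3 ε 1 u) (hs : 0 ≤ s)
    (ht : t ∈ Icc (-(3 * Real.pi)) (3 * Real.pi)) : |lift u (s, t)| ≤ ε * Real.exp s := by
  have hmem : (Real.exp s, t) ∈ polarRect 1 (-(Real.pi * (3 : ℕ))) (Real.pi * (3 : ℕ)) := by
    refine ⟨Real.one_le_exp_iff.2 hs, ?_, ?_⟩ <;> push_cast <;>
      linarith [ht.1, ht.2]
  have hc := h.subset_cone (mem_image_of_mem (graphMap u) hmem)
  simp only [coneComplement, graphMap, mem_ofPred_eq] at hc
  refine abs_le_of_sq_le_sq ?_ (mul_nonneg h.nonneg_eps (Real.exp_pos s).le)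
  have hcs := Real.sin_sq_add_cos_sq t
  have hc' : lift u (s, t) ^ 2
      ≤ ε ^ 2 * ((Real.exp s * Real.cos t) ^ 2 + (Real.exp s * Real.sin t) ^ 2) := by
    simpa [lift] using hc
  refine hc'.trans_eq ?_
  linear_combination (ε ^ 2 * Real.exp s ^ 2) * hcs

theorem differentiableAt_jump {k : ℝ × ℝ → ℝ}
    (hk : ContDiffOn ℝ ∞ k logDomain) (hz : (s, t) ∈ sepDomain) :
    DifferentiableAt ℝ (fun z : ℝ × ℝ => k (z.1, z.2 + 2 * Real.pi) - k z) (s, t) := by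
  have h1 := differentiableAt_of_contDiffOn isOpen_logDomain hk (shift_mem_logDomain hz)
  have h2 := differentiableAt_of_contDiffOn isOpen_logDomain hk (mem_logDomain_of_sepDomain hz)
  exact (h1.comp (s, t) (f := fun z : ℝ × ℝ => (z.1, z.2 + 2 * Real.pi)) (by fun_prop)).sub h2

theorem pd1_jump {k : ℝ × ℝ → ℝ} (hk : ContDiffOn ℝ ∞ k logDomain)
    (hz : (s, t) ∈ sepDomain) :
    pd1 (fun z : ℝ × ℝ => k (z.1, z.2 + 2 * Real.pi) - k z) (s, t)
      = pd1 k (s, t + 2 * Real.pi) - pd1 k (s, t) :=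
  pd1_eq_of_hasDerivAt (differentiableAt_jump hk hz)
    ((hasDerivAt_fst (differentiableAt_of_contDiffOn isOpen_logDomain hk
      (shift_mem_logDomain hz))).sub (hasDerivAt_fst (differentiableAt_of_contDiffOn
        isOpen_logDomain hk (mem_logDomain_of_sepDomain hz))))

theorem pd2_jump {k : ℝ × ℝ → ℝ} (hk : ContDiffOn ℝ ∞ k logDomain)
    (hz : (s, t) ∈ sepDomain) :
    pd2 (fun z : ℝ × ℝ => k (z.1, z.2 + 2 * Real.pi) - k z) (s, t)
      = pd2 k (s, t + 2 * Real.pi) - pd2 k (s, t) :=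
  pd2_eq_of_hasDerivAt (differentiableAt_jump hk hz)
    (((hasDerivAt_snd (differentiableAt_of_contDiffOn isOpen_logDomain hk
      (shift_mem_logDomain hz))).comp_add_const t (2 * Real.pi)).sub
        (hasDerivAt_snd (differentiableAt_of_contDiffOn isOpen_logDomain hk
          (mem_logDomain_of_sepDomain hz))))

theorem lift_dX_separation (h : IsSheet 3 ε 1 u) (hz : (s, t) ∈ sepDomain) :
    lift (dX (separation u)) (s, t)
      = lift (dX u) (s, t + 2 * Real.pi) - lift (dX u) (s, t) := by
  have hd : DifferentiableAt ℝ (lift (separation u)) (s, t) :=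
    differentiableAt_jump h.contDiffOn_lift hz
  have e1 : pd1 (lift (separation u)) (s, t) = _ := pd1_jump h.contDiffOn_lift hz
  have e2 : pd2 (lift (separation u)) (s, t) = _ := pd2_jump h.contDiffOn_lift hz
  change dX (separation u) (Real.exp s) t
    = dX u (Real.exp s) (t + 2 * Real.pi) - dX u (Real.exp s) t
  rw [dX_exp hd, dX_exp (h.differentiableAt_lift (shift_mem_logDomain hz)),
    dX_exp (h.differentiableAt_lift (mem_logDomain_of_sepDomain hz)), e1, e2,
    Real.cos_add_two_pi, Real.sin_add_two_pi]
  ring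

theorem lift_dY_separation (h : IsSheet 3 ε 1 u) (hz : (s, t) ∈ sepDomain) :
    lift (dY (separation u)) (s, t)
      = lift (dY u) (s, t + 2 * Real.pi) - lift (dY u) (s, t) := by
  have hd : DifferentiableAt ℝ (lift (separation u)) (s, t) :=
    differentiableAt_jump h.contDiffOn_lift hz
  have e1 : pd1 (lift (separation u)) (s, t) = _ := pd1_jump h.contDiffOn_lift hz
  have e2 : pd2 (lift (separation u)) (s, t) = _ := pd2_jump h.contDiffOn_lift hz
  change dY (separation u) (Real.exp s) t
    = dY u (Real.exp s) (t + 2 * Real.pi) - dY u (Real.exp s) t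
  rw [dY_exp hd, dY_exp (h.differentiableAt_lift (shift_mem_logDomain hz)),
    dY_exp (h.differentiableAt_lift (mem_logDomain_of_sepDomain hz)), e1, e2,
    Real.cos_add_two_pi, Real.sin_add_two_pi]
  ring

/-- The three consequences of flatness that are used. -/
theorem flat_bounds (h : IsSheet 3 ε 1 u) (hz : (s, t) ∈ sepDomain) :
    lift (separation u) (s, t) ≠ 0 ∧
    Real.exp s * hessNorm u (Real.exp s) t ≤ ε ∧
    Real.exp s * gradNorm (separation u) (Real.exp s) t ≤ ε / 4 * |lift (separation u) (s, t)| ∧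
    Real.exp s * (Real.exp s * hessNorm (separation u) (Real.exp s) t)
      ≤ ε * |lift (separation u) (s, t)| := by
  obtain ⟨h0, hle⟩ := h.flat _ _ (exp_mem_sepRect hz)
  change lift (separation u) (s, t) ≠ 0 at h0
  change _ + _ + 4 * _ * (_ / |lift (separation u) (s, t)|)
    + _ * (_ / |lift (separation u) (s, t)|) ≤ ε at hle
  have hw := abs_pos.2 h0
  generalize |lift (separation u) (s, t)| = W at *
  have he := Real.exp_pos s
  have g1 := gradNorm_nonneg u (Real.exp s) t
  have g2 : 0 ≤ Real.exp s * hessNorm u (Real.exp s) t := mul_nonneg he.le (hessNorm_nonneg _ _ _)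
  have g3 : 0 ≤ 4 * Real.exp s * (gradNorm (separation u) (Real.exp s) t / W) :=
    mul_nonneg (by positivity) (div_nonneg (gradNorm_nonneg _ _ _) hw.le)
  have g4 : 0 ≤ Real.exp s ^ 2 * (hessNorm (separation u) (Real.exp s) t / W) :=
    mul_nonneg (by positivity) (div_nonneg (hessNorm_nonneg _ _ _) hw.le)
  refine ⟨h0, by linarith, ?_, ?_⟩
  · have : 4 * Real.exp s * (gradNorm (separation u) (Real.exp s) t / W) ≤ ε := by linarith
    rw [← mul_div_assoc, div_le_iff₀ hw] at this
    linarith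
  · have : Real.exp s ^ 2 * (hessNorm (separation u) (Real.exp s) t / W) ≤ ε := by linarith
    rw [← mul_div_assoc, div_le_iff₀ hw] at this
    linarith

theorem sq_grad_jump_le (h : IsSheet 3 ε 1 u) (hz : (s, t) ∈ sepDomain) :
    (Real.exp s * (lift (dX u) (s, t + 2 * Real.pi) - lift (dX u) (s, t))) ^ 2
      + (Real.exp s * (lift (dY u) (s, t + 2 * Real.pi) - lift (dY u) (s, t))) ^ 2
      ≤ (ε / 4 * |lift (separation u) (s, t)|) ^ 2 := by
  have h1 := pow_le_pow_left₀ (mul_nonneg (Real.exp_pos s).le (gradNorm_nonneg _ _ _))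
    (h.flat_bounds hz).2.2.1 2
  rw [mul_pow, sq_gradNorm] at h1
  rw [← h.lift_dX_separation hz, ← h.lift_dY_separation hz]
  simp only [lift] at h1 ⊢
  linarith

theorem sq_hess_jump_le (h : IsSheet 3 ε 1 u) (hz : (s, t) ∈ sepDomain) :
    Real.exp s ^ 2 * ((pd1 (lift (dX u)) (s, t + 2 * Real.pi) - pd1 (lift (dX u)) (s, t)) ^ 2
      + (pd2 (lift (dX u)) (s, t + 2 * Real.pi) - pd2 (lift (dX u)) (s, t)) ^ 2
      + (pd1 (lift (dY u)) (s, t + 2 * Real.pi) - pd1 (lift (dY u)) (s, t)) ^ 2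
      + (pd2 (lift (dY u)) (s, t + 2 * Real.pi) - pd2 (lift (dY u)) (s, t)) ^ 2)
      ≤ (ε * |lift (separation u) (s, t)|) ^ 2 := by
  have h1 := pow_le_pow_left₀ (mul_nonneg (Real.exp_pos s).le (mul_nonneg (Real.exp_pos s).le
    (hessNorm_nonneg _ _ _))) (h.flat_bounds hz).2.2.2 2
  have n := isOpen_sepDomain.mem_nhds hz
  have eX : lift (dX (separation u)) =ᶠ[𝓝 (s, t)]
      fun z => lift (dX u) (z.1, z.2 + 2 * Real.pi) - lift (dX u) z := by
    filter_upwards [n] with z hz using h.lift_dX_separation hz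
  have eY : lift (dY (separation u)) =ᶠ[𝓝 (s, t)]
      fun z => lift (dY u) (z.1, z.2 + 2 * Real.pi) - lift (dY u) z := by
    filter_upwards [n] with z hz using h.lift_dY_separation hz
  rw [mul_pow, sq_hessNorm_exp
    ((differentiableAt_jump h.contDiffOn_lift_dX hz).congr_of_eventuallyEq eX)
    ((differentiableAt_jump h.contDiffOn_lift_dY hz).congr_of_eventuallyEq eY),
    pd1_congr eX, pd2_congr eX, pd1_congr eY, pd2_congr eY,
    pd1_jump h.contDiffOn_lift_dX hz, pd2_jump h.contDiffOn_lift_dX hz,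
    pd1_jump h.contDiffOn_lift_dY hz, pd2_jump h.contDiffOn_lift_dY hz] at h1
  exact h1

theorem abs_sep_le (h : IsSheet 3 ε 1 u) (hs : 0 ≤ s) (ht : t ∈ Icc (-(3 * Real.pi)) Real.pi) :
    |lift (separation u) (s, t)| ≤ 2 * ε * Real.exp s := by
  have hπ := Real.pi_pos
  have h1 := h.abs_u_le hs (t := t + 2 * Real.pi) ⟨by linarith [ht.1], by linarith [ht.2]⟩
  have h2 := h.abs_u_le hs (t := t) ⟨ht.1, by linarith [ht.2]⟩
  refine (abs_sub _ _).trans ?_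
  change |lift u (s, t + 2 * Real.pi)| + |lift u (s, t)| ≤ _
  linarith

/-- Flatness bounds the Hessian only for `t < π`. For larger angles go back one turn: the change is
the Hessian of the separation, at most `2ε²` after scaling by `e^s`, hence the factor 2. -/
theorem sq_hess_le (h : IsSheet 3 ε 1 u) (hε : ε ≤ 1 / 2) (hz : (s, t) ∈ logDomain) :
    pd1 (lift (dX u)) (s, t) ^ 2 + pd2 (lift (dX u)) (s, t) ^ 2
      + pd1 (lift (dY u)) (s, t) ^ 2 + pd2 (lift (dY u)) (s, t) ^ 2 ≤ (2 * ε) ^ 2 := by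
  have hπ := Real.pi_pos
  have hε0 := h.nonneg_eps
  have base {t : ℝ} (hz : (s, t) ∈ sepDomain) :
      pd1 (lift (dX u)) (s, t) ^ 2 + pd2 (lift (dX u)) (s, t) ^ 2
        + pd1 (lift (dY u)) (s, t) ^ 2 + pd2 (lift (dY u)) (s, t) ^ 2 ≤ ε ^ 2 := by
    have hz' := mem_logDomain_of_sepDomain hz
    rw [← sq_hessNorm_exp (h.differentiableAt_lift_dX hz') (h.differentiableAt_lift_dY hz')]
    exact pow_le_pow_left₀ (mul_nonneg (Real.exp_pos s).le (hessNorm_nonneg _ _ _))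
      (h.flat_bounds hz).2.1 2
  have h1 : -(3 * Real.pi) < t := hz.2.1
  have h2 : t < 3 * Real.pi := hz.2.2
  rcases lt_or_ge t Real.pi with ht | ht
  · have := base ⟨hz.1, h1, ht⟩
    nlinarith
  · have hz' : (s, t - 2 * Real.pi) ∈ sepDomain :=
      ⟨hz.1, by simp only; linarith, by simp only; linarith⟩
    have hs0 : 0 < s := hz.1
    have b := base hz'
    have j := h.sq_hess_jump_le hz'
    have w := h.abs_sep_le hs0.le (t := t - 2 * Real.pi) ⟨by linarith, by linarith⟩
    rw [sub_add_cancel] at j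
    have j2 := j.trans (pow_le_pow_left₀ (by positivity) (mul_le_mul_of_nonneg_left w hε0) 2)
    rw [show (ε * (2 * ε * Real.exp s)) ^ 2 = Real.exp s ^ 2 * (4 * ε ^ 4) by ring] at j2
    have j3 := le_of_mul_le_mul_left j2 (by positivity)
    have d (x y : ℝ) : x ^ 2 ≤ 2 * y ^ 2 + 2 * (x - y) ^ 2 := by nlinarith [sq_nonneg (x - 2 * y)]
    have d1 := d (pd1 (lift (dX u)) (s, t)) (pd1 (lift (dX u)) (s, t - 2 * Real.pi))
    have d2 := d (pd2 (lift (dX u)) (s, t)) (pd2 (lift (dX u)) (s, t - 2 * Real.pi))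
    have d3 := d (pd1 (lift (dY u)) (s, t)) (pd1 (lift (dY u)) (s, t - 2 * Real.pi))
    have d4 := d (pd2 (lift (dY u)) (s, t)) (pd2 (lift (dY u)) (s, t - 2 * Real.pi))
    have hε4 : ε ^ 4 ≤ 1 / 4 * ε ^ 2 := by
      have : ε ^ 2 ≤ 1 / 4 := by nlinarith
      nlinarith [sq_nonneg ε]
    linarith

theorem continuousOn_sep (h : IsSheet 3 ε 1 u) (ht : t ∈ Icc (-(3 * Real.pi)) Real.pi) :
    ContinuousOn (fun s => lift (separation u) (s, t)) (Ici 0) := by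
  have hπ := Real.pi_pos
  have hc {t : ℝ} (ht : t ∈ Icc (-(3 * Real.pi)) (3 * Real.pi)) :
      ContinuousOn (fun s => u (Real.exp s) t) (Ici 0) := by
    refine h.continuousOn.comp (f := fun s => (Real.exp s, t)) (by fun_prop) fun s hs => ?_
    refine ⟨Real.one_le_exp_iff.2 hs, ?_, ?_⟩ <;> push_cast <;>
      linarith [ht.1, ht.2]
  exact (hc (t := t + 2 * Real.pi) ⟨by linarith [ht.1], by linarith [ht.2]⟩).sub
    (hc (t := t) ⟨ht.1, by linarith [ht.2]⟩)

theorem abs_pd1_sep_le (h : IsSheet 3 ε 1 u) (hz : (s, t) ∈ sepDomain) :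
    |pd1 (lift (separation u)) (s, t)| ≤ ε / 4 * |lift (separation u) (s, t)| := by
  have e1 : pd1 (lift (separation u)) (s, t) = _ := pd1_jump h.contDiffOn_lift hz
  have hj := h.sq_grad_jump_le hz
  have hε0 := h.nonneg_eps
  have hcs := Real.sin_sq_add_cos_sq t
  rw [e1, h.pd1_lift (shift_mem_logDomain hz), h.pd1_lift (mem_logDomain_of_sepDomain hz),
    Real.cos_add_two_pi, Real.sin_add_two_pi]
  refine abs_le_of_sq_le_sq (le_trans ?_ hj) (by positivity)
  generalize lift (dX u) (s, t + 2 * Real.pi) = a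
  generalize lift (dY u) (s, t + 2 * Real.pi) = b
  generalize lift (dX u) (s, t) = c
  generalize lift (dY u) (s, t) = d
  generalize Real.exp s = E
  rw [← sub_nonneg]
  have : (E * (a - c)) ^ 2 + (E * (b - d)) ^ 2 - (E * (Real.cos t * a + Real.sin t * b)
      - E * (Real.cos t * c + Real.sin t * d)) ^ 2
      = (E * (Real.sin t * (a - c) - Real.cos t * (b - d))) ^ 2 := by
    linear_combination (-(E ^ 2 * ((a - c) ^ 2 + (b - d) ^ 2))) * hcs
  rw [this]
  positivity

/-- The separation is positive at `ρ = 1`, continuous up to there, and has no zero beyond. -/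
theorem sep_pos (h : IsSheet 3 ε 1 u) (hC : 0 < C₂)
    (hw : ∀ θ ∈ Icc (-(3 * Real.pi)) Real.pi, C₂ ≤ separation u 1 θ) (hs : 0 ≤ s)
    (ht : t ∈ Ioo (-(3 * Real.pi)) Real.pi) : 0 < lift (separation u) (s, t) := by
  have h0 : 0 < lift (separation u) (0, t) := by
    have := hw t (Ioo_subset_Icc_self ht)
    simp only [lift, Real.exp_zero]; linarith
  by_contra! hneg
  have hc := (h.continuousOn_sep (Ioo_subset_Icc_self ht)).mono
    (Icc_subset_Ici_self : Icc 0 s ⊆ Ici 0)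
  obtain ⟨r, hr, hr0⟩ := intermediate_value_Icc' hs hc ⟨hneg, h0.le⟩
  rcases hr.1.eq_or_lt with rfl | hr1
  · exact h0.ne' hr0
  · exact (h.flat_bounds ⟨hr1, ht⟩).1 hr0

/-- Grönwall's argument for `|∂w/∂s| ≤ (ε/4) w`. The initial values lie between `C₂` and `2ε`, the
latter by the cone condition at `ρ = 1`. -/
theorem sep_bounds (h : IsSheet 3 ε 1 u) (hC : 0 < C₂)
    (hw : ∀ θ ∈ Icc (-(3 * Real.pi)) Real.pi, C₂ ≤ separation u 1 θ) (hs : 0 ≤ s)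
    (ht : t ∈ Ioo (-(3 * Real.pi)) Real.pi) :
    C₂ * Real.exp (-(ε / 4 * s)) ≤ lift (separation u) (s, t) ∧
      lift (separation u) (s, t) ≤ 2 * ε * Real.exp (ε / 4 * s) := by
  have hI := Ioo_subset_Icc_self ht
  have hc := h.continuousOn_sep hI
  have hder (r : ℝ) (hr : 0 < r) : HasDerivAt (fun s => lift (separation u) (s, t))
      (pd1 (lift (separation u)) (r, t)) r :=
    hasDerivAt_fst (differentiableAt_jump h.contDiffOn_lift
      (show (r, t) ∈ sepDomain from ⟨hr, ht⟩))
  have hb (r : ℝ) (hr : 0 < r) := abs_le.1 (h.abs_pd1_sep_le (show (r, t) ∈ sepDomain from ⟨hr, ht⟩))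
  have hdexp (a r : ℝ) : HasDerivAt (fun s => Real.exp (a * s)) (Real.exp (a * r) * a) r := by
    simpa using ((hasDerivAt_id r).const_mul a).exp
  have hlow : MonotoneOn (fun s => lift (separation u) (s, t) * Real.exp (ε / 4 * s)) (Ici 0) := by
    refine monotoneOn_of_deriv_nonneg (convex_Ici 0) (hc.mul (by fun_prop)) ?_ ?_ <;>
      rw [interior_Ici] <;> intro r hr
    · exact ((hder r hr).fun_mul (hdexp _ r)).differentiableAt.differentiableWithinAt
    · rw [((hder r hr).fun_mul (hdexp _ r)).deriv]
      have h1 := (hb r hr).1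
      rw [abs_of_pos (h.sep_pos hC hw (le_of_lt hr) ht)] at h1
      nlinarith [Real.exp_pos (ε / 4 * r)]
  have hup : AntitoneOn (fun s => lift (separation u) (s, t) * Real.exp (-(ε / 4) * s))
      (Ici 0) := by
    refine antitoneOn_of_deriv_nonpos (convex_Ici 0) (hc.mul (by fun_prop)) ?_ ?_ <;>
      rw [interior_Ici] <;> intro r hr
    · exact ((hder r hr).fun_mul (hdexp _ r)).differentiableAt.differentiableWithinAt
    · rw [((hder r hr).fun_mul (hdexp _ r)).deriv]
      have h1 := (hb r hr).2
      rw [abs_of_pos (h.sep_pos hC hw (le_of_lt hr) ht)] at h1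
      nlinarith [Real.exp_pos (-(ε / 4) * r)]
  have e : Real.exp (ε / 4 * s) * Real.exp (-(ε / 4 * s)) = 1 := by
    rw [← Real.exp_add]; simp
  have h0 : lift (separation u) (0, t) = separation u 1 t := by simp [lift]
  have l := hlow (mem_Ici.2 le_rfl) (mem_Ici.2 hs) hs
  have k := hup (mem_Ici.2 le_rfl) (mem_Ici.2 hs) hs
  have hw0 := hw t hI
  have hw1 := (le_abs_self _).trans (h.abs_sep_le le_rfl hI)
  simp only [mul_zero, Real.exp_zero, mul_one, neg_mul] at l k hw1
  rw [h0] at l k hw1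
  constructor
  · have := mul_le_mul_of_nonneg_right (hw0.trans l) (Real.exp_pos (-(ε / 4 * s))).le
    rwa [mul_assoc, e, mul_one] at this
  · have := mul_le_mul_of_nonneg_right (k.trans hw1) (Real.exp_pos (ε / 4 * s)).le
    rwa [mul_assoc, mul_comm (Real.exp (-(ε / 4 * s))), e, mul_one] at this

/-- A sheet in the coordinates `(log ρ, θ)`. -/
theorem logPolarSheet (h : IsSheet 3 ε 1 u) (hε : ε ≤ 1 / 2) (hC : 0 < C₂)
    (hw : ∀ θ ∈ Icc (-(3 * Real.pi)) Real.pi, C₂ ≤ separation u 1 θ) :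
    LogPolarSheet ε C₂ (lift u) (lift (dX u)) (lift (dY u)) := by
  have hε0 := h.nonneg_eps
  -- All three jumps follow from `e^s |x| ≤ ε w ≤ 2ε² e^{εs/4} ≤ e^{s/2}`.
  have small (s t : ℝ) (hs : 0 < s) (ht : t ∈ Ioo (-(3 * Real.pi)) Real.pi) (x : ℝ)
      (hx : (Real.exp s * x) ^ 2 ≤ (ε * |lift (separation u) (s, t)|) ^ 2) :
      |x| ≤ Real.exp (-(1 / 2 * s)) := by
    have h1 := abs_le_of_sq_le_sq hx (by positivity)
    rw [abs_mul, Real.abs_exp, abs_of_pos (h.sep_pos hC hw hs.le ht)] at h1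
    have h2 := mul_le_mul_of_nonneg_left (h.sep_bounds hC hw hs.le ht).2 hε0
    have h3 : Real.exp (ε / 4 * s) ≤ Real.exp (1 / 2 * s) :=
      Real.exp_le_exp.2 (mul_le_mul_of_nonneg_right (by linarith) hs.le)
    have h4 : ε * (2 * ε * Real.exp (ε / 4 * s)) ≤ Real.exp (1 / 2 * s) := by
      have : ε * (2 * ε) ≤ 1 := by nlinarith
      nlinarith [Real.exp_pos (ε / 4 * s)]
    have h5 : Real.exp s * Real.exp (-(1 / 2 * s)) = Real.exp (1 / 2 * s) := by
      rw [← Real.exp_add]; ring_nf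
    rw [← h5] at h4
    exact le_of_mul_le_mul_left (h1.trans (h2.trans h4)) (Real.exp_pos s)
  have quarter (s t : ℝ) : (ε / 4 * |lift (separation u) (s, t)|) ^ 2
      ≤ (ε * |lift (separation u) (s, t)|) ^ 2 := by
    apply pow_le_pow_left₀ (by positivity)
    exact mul_le_mul_of_nonneg_right (by linarith) (abs_nonneg _)
  refine
    { eps_nonneg := hε0
      smooth_v := h.contDiffOn_lift
      smooth_p := h.contDiffOn_lift_dX
      smooth_q := h.contDiffOn_lift_dY
      pd1_v := fun s t hz => h.pd1_lift hz
      pd2_v := fun s t hz => h.pd2_lift hz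
      grad_le := fun s t hz => h.sq_grad_le hz
      minimal := fun s t hz => h.minimal_lift hz
      hess_le := fun s t hz => h.sq_hess_le hε hz
      jump_p := fun s t hs ht => small s t hs ht _ ?_
      jump_q := fun s t hs ht => small s t hs ht _ ?_
      jump_pd1_q := fun s t hs ht => small s t hs ht _ ?_
      abs_v_le := fun s t hz => h.abs_u_le (le_of_lt hz.1) (Ioo_subset_Icc_self hz.2)
      le_sep := fun s t hs ht => (h.sep_bounds hC hw hs.le ht).1
      C₂_le := ?_
      tendsto_p := h.tendsto_dX.comp Real.tendsto_exp_atTop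
      tendsto_q := h.tendsto_dY.comp Real.tendsto_exp_atTop }
  · refine le_trans ?_ ((h.sq_grad_jump_le ⟨hs, ht⟩).trans (quarter s t))
    exact le_add_of_nonneg_right (sq_nonneg _)
  · refine le_trans ?_ ((h.sq_grad_jump_le ⟨hs, ht⟩).trans (quarter s t))
    exact le_add_of_nonneg_left (sq_nonneg _)
  · refine le_trans ?_ (h.sq_hess_jump_le ⟨hs, ht⟩)
    rw [mul_pow]
    refine mul_le_mul_of_nonneg_left ?_ (by positivity)
    rw [add_right_comm]
    exact le_add_of_nonneg_left (by positivity)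
  · have hI : (0 : ℝ) ∈ Icc (-(3 * Real.pi)) Real.pi := by
      constructor <;> linarith [Real.pi_pos]
    have h1 := hw 0 hI
    have h2 := (le_abs_self _).trans (h.abs_sep_le le_rfl hI)
    simp only [lift, Real.exp_zero, mul_one] at h2
    linarith

end IsSheet

end Conversion

end MultiGraph

/-! ### Return to the radius -/

theorem mainTheorem10 :
    ∃ ε₀ : ℝ, 0 < ε₀ ∧
      ∀ C₂ : ℝ, 0 < C₂ →
        ∃ C₃ : ℝ, 2 ≤ C₃ ∧
          ∀ (ε : ℝ) (u : ℝ → ℝ → ℝ), ε < ε₀ →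
            MultiGraph.IsSheet 3 ε 1 u →
            (∀ θ ∈ Set.Icc (-(3 * Real.pi)) Real.pi, C₂ ≤ MultiGraph.separation u 1 θ) →
            ∀ ρ θ : ℝ, (ρ, θ) ∈ MultiGraph.polarRect C₃ (-Real.pi) Real.pi →
              C₂ / (8 * Real.pi) * ρ ^ (-ε) ≤ MultiGraph.dTheta u ρ θ ∧
                MultiGraph.dTheta u ρ θ ≠ 0 := by
  refine ⟨1 / 10000, by norm_num, fun C₂ hC => ?_⟩
  obtain ⟨S₀, hS₀, H⟩ := MultiGraph.exists_forall_le_pd2 hC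
  -- `S₀ ≥ log 2`, where the comparison region begins, gives `C₃ ≥ 2`.
  refine ⟨Real.exp S₀, (Real.log_le_iff_le_exp (by norm_num)).1 hS₀,
    fun ε u hε hu hw ρ θ hz => ?_⟩
  have hπ := Real.pi_pos
  have hρS : Real.exp S₀ ≤ ρ := hz.1
  have hθ : θ ∈ Set.Icc (-Real.pi) Real.pi := hz.2
  have hρ : 0 < ρ := (Real.exp_pos _).trans_le hρS
  have hs : S₀ ≤ Real.log ρ := (Real.le_log_iff_exp_le hρ).2 hρS
  have hs0 : 0 < Real.log ρ := (Real.log_pos (by norm_num)).trans_le (hS₀.trans hs)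
  have hL := hu.logPolarSheet (by linarith) hC hw
  have key := H ε _ _ _ hε hL (Real.log ρ) θ hs hθ
  have hmem : (Real.log ρ, θ) ∈ MultiGraph.logDomain :=
    ⟨hs0, by linarith [hθ.1], by linarith [hθ.2]⟩
  have hd := MultiGraph.dTheta_exp (hu.differentiableAt_lift hmem)
  rw [Real.exp_log hρ] at hd
  have hpow : ρ ^ (-ε) = Real.exp (-ε * Real.log ρ) := by
    rw [Real.rpow_def_of_pos hρ, mul_comm]
  rw [hd, hpow]
  refine ⟨key, ne_of_gt (lt_of_lt_of_le ?_ key)⟩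
  positivity
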